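/- Let $N\ge 1$, $r\ge 2$, $\mathfrak g=sl(r,\mathbb C)$, identified with $\mathfrak g^*$ by the trace form, and $M=\mathfrak g^N\ni A=(A_1,\dots,A_N)$. For a holomorphic function $F$ on $M$ let $\partial F/\partial A_j\in\mathfrak g$ be its trace-form gradients. Let $P$ be the Lie–Poisson tensor, $(P\,dF)_i=[A_i,\partial F/\partial A_i]$, and let $R$ be given by $(R\,dF)_i=\sum_j[c_{ij},\partial F/\partial A_j]$ with $c_{ij}=A_{\min(i,j)}$ for $i\ne j$ and $c_{ii}=(i-1)A_i-\sum_{k<i}A_k$. Put $\{F,G\}_P=\langle dF,P\,dG\rangle$ and $\{F,G\}_R=\langle dF,R\,dG\rangle$. For $2\le l\le N$ let $B_l=\sum_{i<l}A_i$, let $H^{(\alpha)}_{\beta,l}$ be the coefficient of $\lambda^\alpha$ in $\mathrm{tr}\,(\lambda A_l+B_l)^\beta$, and let $K^{(\beta)}_{\beta,l}=H^{(\beta)}_{\beta,l}$ and $$K^{(\beta-k)}_{\beta,l}=\sum_{j=0}^{k-1}\binom{k-1}{j}(l-2)^{k-1-j}H^{(\beta-1-j)}_{\beta,l}\qquad(1\le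 k\le\beta).$$ Then the following hold. 1. (Lenard chains of $R-\lambda P$.) For $2\le l\le N$ and all $\beta\ge 0$: $P\,dK^{(\alpha-1)}_{\beta,l}=R\,dK^{(\alpha)}_{\beta,l}$ for $1\le\alpha\le\beta$; the chain starts at $K^{(\beta)}_{\beta,l}=\mathrm{tr}\,A_l^\beta$; and $\{K^{(\alpha)}_{\beta,l}\}_{1\le\alpha\le\beta-1}$ and $\{H^{(\alpha)}_{\beta,l}\}_{1\le\alpha\le\beta-1}$ have the same linear span. 2. (Casimirs.) All functions $\mathrm{tr}\,A_i^\beta$ ($1\le i\le N$) are Casimirs of $P$, and the $\mathrm{tr}\,A_1^\beta$ are Casimirs of $R$ as well. 3. (Complete family.) Consider * the $N(r-1)$ Casimirs $\mathrm{tr}\,A_i^\beta$, $1\le i\le N$, $2\le\beta\le r$; * the $(N-1)\frac{r(r-1)}2$ chain Hamiltonians $H^{(\alpha)}_{\beta,l}$, $2\le l\le N$, $2\le\beta\le r$, $1\le\alpha\le\beta-1$; * the following $\frac{r(r-1)}2$ functions of $A_{tot}=\sum_iA_i$: the $r-1$ Cartan functions $\mathrm{tr}\,(A_{tot}h_k)$,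 $h_k=E_{kk}-E_{k+1,k+1}$, $1\le k\le r-1$, and the Gel'fand–Cetlin functions $\mathrm{tr}\,\big((\pi_mA_{tot})^\beta\big)$, $2\le m\le r-1$, $2\le\beta\le m$, where $\pi_mX$ is the trace-free part of the upper left $m\times m$ block of $X$. These functions are holomorphic and pairwise in involution for both $\{\cdot,\cdot\}_P$ and $\{\cdot,\cdot\}_R$. On an open dense subset of $M$ their differentials are linearly independent and their number is the maximal possible one, $\frac12(\dim M+\mathrm{corank}\,P)$. 4. (Liouville integrability.) The homogeneous Gaudin Hamiltonian $H_G=\sum_{i\ne j}\mathrm{tr}(A_iA_j)$ equals $\sum_{l=2}^NH^{(1)}_{2,l}$ and is Liouville integrable on the generic symplectic leaves of $P$, in the following sense. The functions of the last two groups in 3 are in involution with $H_G$ and with each other for $\{\cdot,\cdot\}_P$. There is an open dense set $U\subseteq M$ such that every symplectic leaf $S$ of $P$ (that is, every coadjoint orbit $\{(g_iA_ig_i^{-1})_i\}$) which meets $U$ meets it in a dense subset of $S$, and at each point of $S\cap U$ the leaf has dimension twice the number of these functions, i.e. $Nr(r-1)$, and their restrictions to $S$ have linearly independent differentials. -/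

import Mathlib

namespace Gaudin

/-- The complex Lie algebra `sl(r)` of trace-free `r × r` matrices. -/
abbrev Sl (r : ℕ) : Type := LieAlgebra.SpecialLinear.sl (Fin r) ℂ

/-- The inclusion of `sl(r)` into the matrices. -/
def slIncl (r : ℕ) : Sl r →ₗ[ℂ] Matrix (Fin r) (Fin r) ℂ :=
  { toFun := fun X => X.val, map_add' := fun _ _ => rfl, map_smul' := fun _ _ => rfl }

section Norm

attribute [local instance] Matrix.normedAddCommGroup Matrix.normedSpace

/-- `sl(r)` with the entrywise sup norm inherited from matrices. Only the topology and the
resulting notion of complex derivative matter. -/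
noncomputable instance instNormedAddCommGroupSl (r : ℕ) : NormedAddCommGroup (Sl r) :=
  NormedAddCommGroup.induced (Sl r) (Matrix (Fin r) (Fin r) ℂ) (slIncl r)
    (fun _ _ h => Subtype.ext h)

noncomputable instance instNormedSpaceSl (r : ℕ) : NormedSpace ℂ (Sl r) :=
  NormedSpace.induced ℂ (Sl r) (Matrix (Fin r) (Fin r) ℂ) (slIncl r)

end Norm

/-- The topology of `sl(r)` is that of the norm (it is the one induced by the inclusion into the
matrices, see `topology_eq`). -/
noncomputable instance instTopologicalSpaceSl (r : ℕ) : TopologicalSpace (Sl r) :=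
  (instNormedAddCommGroupSl r).toMetricSpace.toPseudoMetricSpace.toUniformSpace.toTopologicalSpace

theorem topology_eq (r : ℕ) :
    instTopologicalSpaceSl r = TopologicalSpace.induced (slIncl r) inferInstance := rfl

/-- The phase space `sl(r)^N`; its points are the `N`-tuples `(A_1, …, A_N)`. Sites are
numbered from `0`, so the site `l` here is the site `l + 1` of the usual notation. -/
abbrev Phase (N r : ℕ) : Type := Fin N → Sl r

/-- The trace-free part `X - (tr X / m) 1` of an `m × m` matrix. -/
noncomputable def tracelessPart {m : ℕ} (X : Matrix (Fin m) (Fin m) ℂ) :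
    Matrix (Fin m) (Fin m) ℂ :=
  X - (X.trace / (m : ℂ)) • (1 : Matrix (Fin m) (Fin m) ℂ)

theorem tracelessPart_mem {m : ℕ} (X : Matrix (Fin m) (Fin m) ℂ) :
    tracelessPart X ∈ LieAlgebra.SpecialLinear.sl (Fin m) ℂ := by
  change Matrix.trace (tracelessPart X) = 0
  rcases Nat.eq_zero_or_pos m with rfl | hm
  · simp [Matrix.trace]
  · have : (m : ℂ) ≠ 0 := by exact_mod_cast hm.ne'
    simp [tracelessPart, Matrix.trace_sub, Matrix.trace_smul, Matrix.trace_one, this]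

/-- The trace-free part, as an element of `sl(m)`. -/
noncomputable def toSl {m : ℕ} (X : Matrix (Fin m) (Fin m) ℂ) : Sl m :=
  ⟨tracelessPart X, tracelessPart_mem X⟩

/-- The matrix representing a linear form `φ` on `sl(r)` through the trace form:
`φ Ξ = tr (X Ξ)` with `X_{ab} = φ (trace-free part of E_{ba})`. See `trace_traceDual_mul`. -/
noncomputable def traceDualMatrix {r : ℕ} (φ : Module.Dual ℂ (Sl r)) :
    Matrix (Fin r) (Fin r) ℂ :=
  Matrix.of fun a b => φ (toSl (Matrix.single b a 1))

/-- The trace-free part as a linear map. -/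
noncomputable def toSlLin (m : ℕ) : Matrix (Fin m) (Fin m) ℂ →ₗ[ℂ] Sl m where
  toFun := toSl
  map_add' X Y := by
    apply Subtype.ext
    change tracelessPart (X + Y) = tracelessPart X + tracelessPart Y
    simp only [tracelessPart, Matrix.trace_add, add_div, add_smul]
    abel
  map_smul' c X := by
    apply Subtype.ext
    change tracelessPart (c • X) = c • tracelessPart X
    simp only [tracelessPart, Matrix.trace_smul, smul_eq_mul, smul_sub, smul_smul, mul_div_assoc]

theorem traceDualMatrix_mem {r : ℕ} (φ : Module.Dual ℂ (Sl r)) :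
    traceDualMatrix φ ∈ LieAlgebra.SpecialLinear.sl (Fin r) ℂ := by
  change Matrix.trace (traceDualMatrix φ) = 0
  have h1 : Matrix.trace (traceDualMatrix φ)
      = φ (toSlLin r (∑ a, Matrix.single a a (1 : ℂ))) := by
    rw [map_sum, map_sum]; rfl
  have h2 : ∑ a, Matrix.single a a (1 : ℂ) = (1 : Matrix (Fin r) (Fin r) ℂ) := by
    ext i j
    rw [Matrix.sum_apply, Finset.sum_eq_single i]
    · simp [Matrix.single_apply, Matrix.one_apply]
    · intro b _ hb
      simp [hb]
    · simp
  have h3 : toSlLin r 1 = 0 := by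
    apply Subtype.ext
    change tracelessPart 1 = 0
    rcases Nat.eq_zero_or_pos r with rfl | hm
    · exact Subsingleton.elim _ _
    · have : (r : ℂ) ≠ 0 := by exact_mod_cast hm.ne'
      simp [tracelessPart, Matrix.trace_one, this]
  rw [h1, h2, h3, map_zero]

/-- The identification of `sl(r)*` with `sl(r)` through the trace form. -/
noncomputable def traceDual {r : ℕ} (φ : Module.Dual ℂ (Sl r)) : Sl r :=
  ⟨traceDualMatrix φ, traceDualMatrix_mem φ⟩

theorem toSl_coe {r : ℕ} (Ξ : Sl r) : toSl (Ξ : Matrix (Fin r) (Fin r) ℂ) = Ξ := by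
  apply Subtype.ext
  have h : Matrix.trace (Ξ : Matrix (Fin r) (Fin r) ℂ) = 0 := Ξ.2
  change tracelessPart (Ξ : Matrix (Fin r) (Fin r) ℂ) = Ξ
  simp [tracelessPart, h]

/-- The defining property of `traceDual`. -/
theorem trace_traceDual_mul {r : ℕ} (φ : Module.Dual ℂ (Sl r)) (Ξ : Sl r) :
    Matrix.trace ((traceDual φ : Matrix (Fin r) (Fin r) ℂ) * (Ξ : Matrix (Fin r) (Fin r) ℂ))
      = φ Ξ := by
  have h : φ Ξ = φ (toSlLin r (∑ i, ∑ j, Matrix.single i j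
      ((Ξ : Matrix (Fin r) (Fin r) ℂ) i j))) := by
    rw [← Matrix.matrix_eq_sum_single]
    exact congrArg φ (toSl_coe Ξ).symm
  rw [h]
  simp only [map_sum]
  rw [Matrix.trace]
  simp only [Matrix.diag_apply, Matrix.mul_apply]
  rw [Finset.sum_comm]
  refine Finset.sum_congr rfl fun i _ => Finset.sum_congr rfl fun j _ => ?_
  have : Matrix.single i j ((Ξ : Matrix (Fin r) (Fin r) ℂ) i j)
      = ((Ξ : Matrix (Fin r) (Fin r) ℂ) i j) • Matrix.single i j (1 : ℂ) := by
    simp [Matrix.smul_single]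
  rw [this, map_smul, map_smul, smul_eq_mul, mul_comm]
  rfl

theorem traceDual_add {r : ℕ} (φ ψ : Module.Dual ℂ (Sl r)) :
    traceDual (φ + ψ) = traceDual φ + traceDual ψ := rfl

theorem traceDual_smul {r : ℕ} (c : ℂ) (φ : Module.Dual ℂ (Sl r)) :
    traceDual (c • φ) = c • traceDual φ := rfl

/-- The `j`-th component, in `sl(r)`, of a covector `ξ` on `sl(r)^N`. For `ξ = dF(A)` this is
the matrix `∂F/∂A_j`. -/
noncomputable def comp {N r : ℕ} (ξ : Module.Dual ℂ (Phase N r)) (j : Fin N) : Sl r :=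
  traceDual (ξ ∘ₗ LinearMap.single ℂ (fun _ : Fin N => Sl r) j)

/-- The differential `dF(A)` of a function on the phase space. -/
noncomputable def diff {N r : ℕ} (F : Phase N r → ℂ) (A : Phase N r) :
    Module.Dual ℂ (Phase N r) :=
  (fderiv ℂ F A).toLinearMap

/-- A linear bivector: given the block entries `c i j ∈ sl(r)`, the map sending a covector `ξ` to
the tangent vector with `i`-th component `∑_j [c i j, ξ_j]`. -/
noncomputable def blockTensor {N r : ℕ} (c : Fin N → Fin N → Sl r) :
    Module.Dual ℂ (Phase N r) →ₗ[ℂ] Phase N r where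
  toFun ξ i := ∑ j, ⁅c i j, comp ξ j⁆
  map_add' ξ η := by
    funext i
    have h : ∀ j, comp (ξ + η) j = comp ξ j + comp η j := fun j => by
      unfold comp; rw [LinearMap.add_comp, traceDual_add]
    simp [h, lie_add, Finset.sum_add_distrib]
  map_smul' a ξ := by
    funext i
    have h : ∀ j, comp (a • ξ) j = a • comp ξ j := fun j => by
      unfold comp; rw [LinearMap.smul_comp, traceDual_smul]
    simp [h, lie_smul, Finset.smul_sum]

/-- The diagonal (standard Lie–Poisson) tensor `P` at `A`: `(P ξ)_i = [A_i, ξ_i]`. -/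
noncomputable def tensorP {N r : ℕ} (A : Phase N r) :
    Module.Dual ℂ (Phase N r) →ₗ[ℂ] Phase N r :=
  blockTensor fun i j => if i = j then A i else 0

/-- The tensor `R` at `A`: the entry `(i,j)` is `[A_{min(i,j)}, ·]` if `i ≠ j`, and the `i`-th
diagonal entry (counting from `1`) is `[(i-1) A_i - ∑_{k<i} A_k, ·]`. -/
noncomputable def tensorR {N r : ℕ} (A : Phase N r) :
    Module.Dual ℂ (Phase N r) →ₗ[ℂ] Phase N r :=
  blockTensor fun i j =>
    if i = j then (i.val : ℂ) • A i - ∑ k ∈ Finset.univ.filter (· < i), A k else A (min i j)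

/-- `{F, G}_P = ⟨dF, P dG⟩`. -/
noncomputable def bracketP {N r : ℕ} (F G : Phase N r → ℂ) (A : Phase N r) : ℂ :=
  diff F A (tensorP A (diff G A))

/-- `{F, G}_R = ⟨dF, R dG⟩`. -/
noncomputable def bracketR {N r : ℕ} (F G : Phase N r → ℂ) (A : Phase N r) : ℂ :=
  diff F A (tensorR A (diff G A))

/-- The symplectic leaf of `P` through `A`: the coadjoint orbit
`{(g_1 A_1 g_1⁻¹, …, g_N A_N g_N⁻¹)}`. -/
def leaf {N r : ℕ} (A : Phase N r) : Set (Phase N r) :=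
  {B | ∀ i, ∃ g : GL (Fin r) ℂ, (B i : Matrix (Fin r) (Fin r) ℂ)
    = (g : Matrix (Fin r) (Fin r) ℂ) * (A i : Matrix (Fin r) (Fin r) ℂ)
      * ((g⁻¹ : GL (Fin r) ℂ) : Matrix (Fin r) (Fin r) ℂ)}

/-- The tangent space at `A` of the symplectic leaf through `A`: the range of `P`, i.e. the span
of the Hamiltonian vector fields. -/
noncomputable def leafTangent {N r : ℕ} (A : Phase N r) : Submodule ℂ (Phase N r) :=
  LinearMap.range (tensorP A)

/-- `B_l = ∑_{i<l} A_i`. -/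
noncomputable def partialSum {N r : ℕ} (A : Phase N r) (l : Fin N) : Sl r :=
  ∑ i ∈ Finset.univ.filter (· < l), A i

/-- `F^{(α)}_{β,l}`: the coefficient of `λ^α` in `(λ A_l + B_l)^β`. -/
noncomputable def lenardF {N r : ℕ} (α β : ℕ) (l : Fin N) (A : Phase N r) :
    Matrix (Fin r) (Fin r) ℂ :=
  ((Polynomial.X * Polynomial.C (A l : Matrix (Fin r) (Fin r) ℂ)
    + Polynomial.C (partialSum A l : Matrix (Fin r) (Fin r) ℂ)) ^ β).coeff α

/-- `H^{(α)}_{β,l} = tr F^{(α)}_{β,l}`. -/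
noncomputable def lenardH {N r : ℕ} (α β : ℕ) (l : Fin N) (A : Phase N r) : ℂ :=
  (lenardF α β l A).trace

/-- `K^{(α)}_{β,l}` for `α ≤ β`: with `k = β - α`, it is `H^{(β)}_{β,l}` if `k = 0` and
`∑_{j=0}^{k-1} C(k-1,j) (l-2)^{k-1-j} H^{(β-1-j)}_{β,l}` if `k ≥ 1`, where `l` counts sites
from `1`; in the numbering from `0` used here `l - 2` becomes `l - 1`. -/
noncomputable def lenardK {N r : ℕ} (α β : ℕ) (l : Fin N) (A : Phase N r) : ℂ :=
  if β - α = 0 then lenardH β β l A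
  else ∑ j ∈ Finset.range (β - α), ((β - α - 1).choose j : ℂ)
    * ((l.val : ℂ) - 1) ^ (β - α - 1 - j) * lenardH (β - 1 - j) β l A

/-- `tr (A_i^β)`. -/
noncomputable def casimir {N r : ℕ} (β : ℕ) (i : Fin N) (A : Phase N r) : ℂ :=
  ((A i : Matrix (Fin r) (Fin r) ℂ) ^ β).trace

/-- `A_tot = ∑_i A_i`. -/
noncomputable def total {N r : ℕ} (A : Phase N r) : Sl r := ∑ i, A i

/-- The linear function `H_τ = tr (A_tot τ)`. -/
noncomputable def linearH {N r : ℕ} (τ : Matrix (Fin r) (Fin r) ℂ) (A : Phase N r) : ℂ :=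
  ((total A : Matrix (Fin r) (Fin r) ℂ) * τ).trace

/-- The matrix `h = E_{kk} - E_{k+1,k+1}` of the standard basis of the Cartan subalgebra. -/
noncomputable def cartanMatrix {r : ℕ} (k : Fin (r - 1)) : Matrix (Fin r) (Fin r) ℂ :=
  Matrix.diagonal fun a =>
    (if a.val = k.val then (1 : ℂ) else 0) - (if a.val = k.val + 1 then (1 : ℂ) else 0)

/-- The Gel'fand–Cetlin function attached to the Casimir `tr X^β` of `sl(m) ⊆ sl(r)` (upper left
corner): `tr (X^β)`, where `X` is the projection of `A_tot` to `sl(m)`, that is, the trace-free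
part of its upper left `m × m` block. -/
noncomputable def gelfandCetlin {N r : ℕ} (m β : ℕ) (hm : m ≤ r) (A : Phase N r) : ℂ :=
  (tracelessPart ((total A : Matrix (Fin r) (Fin r) ℂ).submatrix
    (Fin.castLE hm) (Fin.castLE hm)) ^ β).trace

/-- The homogeneous Gaudin Hamiltonian `H_G = ∑_{i ≠ j} tr (A_i A_j)`. -/
noncomputable def gaudinH {N r : ℕ} (A : Phase N r) : ℂ :=
  ∑ i, ∑ j ∈ Finset.univ.filter (· ≠ i),
    ((A i : Matrix (Fin r) (Fin r) ℂ) * (A j : Matrix (Fin r) (Fin r) ℂ)).trace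

/-- Pairs (site, `β`) with `β = 2, …, r`. -/
abbrev CasimirIdx (N r : ℕ) : Type := Fin N × Fin (r - 1)

/-- Triples (site `l = 2, …, N`, degree `β = 2, …, r`, exponent `α = 1, …, β - 1`). -/
abbrev ChainIdx (N r : ℕ) : Type := Fin (N - 1) × (Σ b : Fin (r - 1), Fin (b.val + 1))

/-- The `r - 1` standard Cartan elements. -/
abbrev CartanIdx (r : ℕ) : Type := Fin (r - 1)

/-- Pairs (`m = 2, …, r - 1`, degree `β = 2, …, m`). -/
abbrev GCIdx (r : ℕ) : Type := Σ m : Fin (r - 2), Fin (m.val + 1)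

/-- The functions `tr (A_i^β)`, `β = 2, …, r`. -/
noncomputable def casimirFamily (N r : ℕ) : CasimirIdx N r → Phase N r → ℂ :=
  fun s => casimir (s.2.val + 2) s.1

/-- The functions `H^{(α)}_{β,l}`, `l = 2, …, N`, `β = 2, …, r`, `α = 1, …, β - 1`. -/
noncomputable def chainFamily (N r : ℕ) : ChainIdx N r → Phase N r → ℂ :=
  fun s => lenardH (s.2.2.val + 1) (s.2.1.val + 2)
    (⟨s.1.val + 1, Nat.add_lt_of_lt_sub s.1.isLt⟩ : Fin N)

/-- The Cartan linear functions of `A_tot` and the Gel'fand–Cetlin functions of `A_tot` for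
`sl(2) ⊂ ⋯ ⊂ sl(r-1)`. -/
noncomputable def extraFamily (N r : ℕ) : CartanIdx r ⊕ GCIdx r → Phase N r → ℂ :=
  Sum.elim (fun k => linearH (cartanMatrix k))
    (fun s => gelfandCetlin (s.1.val + 2) (s.2.val + 2) (Nat.add_lt_of_lt_sub s.1.isLt).le)

/-- The Hamiltonians that are not Casimirs. -/
noncomputable def hamiltonianFamily (N r : ℕ) :
    ChainIdx N r ⊕ (CartanIdx r ⊕ GCIdx r) → Phase N r → ℂ :=
  Sum.elim (chainFamily N r) (extraFamily N r)

/-- The whole family. -/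
noncomputable def fullFamily (N r : ℕ) :
    CasimirIdx N r ⊕ (ChainIdx N r ⊕ (CartanIdx r ⊕ GCIdx r)) → Phase N r → ℂ :=
  Sum.elim (casimirFamily N r) (hamiltonianFamily N r)

/-- A complete involutive family for `P`: holomorphic functions, in involution, with linearly
independent differentials on an open dense set on which their number is the maximal possible
one, `(dim M + corank P) / 2`. -/
structure IsCompleteInvolutive {N r : ℕ} {ι : Type} [Fintype ι]
    (f : ι → Phase N r → ℂ) : Prop where
  differentiable : ∀ s, Differentiable ℂ (f s)
  involutive : ∀ s t A, bracketP (f s) (f t) A = 0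
  complete : ∃ U : Set (Phase N r), IsOpen U ∧ Dense U ∧ ∀ A ∈ U,
    LinearIndependent ℂ (fun s => diff (f s) A) ∧
    2 * Fintype.card ι
      = Module.finrank ℂ (Phase N r) + Module.finrank ℂ (LinearMap.ker (tensorP A))

/-- The Hamiltonian `h` is Liouville integrable on the generic symplectic leaves of `P` by means
of the integrals `f`: they are in involution with `h` and among themselves, and there is an open
dense set `U` of the phase space such that each leaf that meets `U` meets it in a dense subset of
the leaf, at all points of which the leaf has twice as many dimensions as there are integrals and
the restrictions of the integrals to the leaf have linearly independent differentials. -/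
structure IsLiouvilleIntegrable {N r : ℕ} {ι : Type} [Fintype ι]
    (h : Phase N r → ℂ) (f : ι → Phase N r → ℂ) : Prop where
  differentiable_ham : Differentiable ℂ h
  differentiable : ∀ s, Differentiable ℂ (f s)
  commute_ham : ∀ s A, bracketP h (f s) A = 0
  involutive : ∀ s t A, bracketP (f s) (f t) A = 0
  independent : ∃ U : Set (Phase N r), IsOpen U ∧ Dense U ∧
    (∀ A ∈ U, leaf A ⊆ closure (leaf A ∩ U)) ∧
    ∀ A ∈ U, Module.finrank ℂ (leafTangent A) = 2 * Fintype.card ι ∧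
      LinearIndependent ℂ (fun s => (diff (f s) A).domRestrict (leafTangent A))

end Gaudin

/-!
The matrices `A_l` and `B_l = ∑_{i<l} A_i` enter only through the pencil `λ A_l + B_l`. Let `F_n^k`
be the coefficient of `λ ^ k` in `(λ A_l + B_l) ^ n` (`pencil`). Then `H^{(α)}_{β,l}` has the
gradient `β F_{β-1}^{α-1}` at the site `l`, the constant gradient `β F_{β-1}^α` at the sites before
`l`, and no gradient after it (`hasGrad_lenardH`).

*Chains.* Comparing coefficients in `[λ A_l + B_l, (λ A_l + B_l) ^ n] = 0` gives
`[A_l, F_n^{k-1}] + [B_l, F_n^k] = 0`. With it, `R` on such a step gradient is computed site by site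
(`tensorR_stepGrad`), and the result is the recursion
`R dH^{(α)} = P dH^{(α-1)} + (l - 2) P dH^{(α)}` (with `l` counted from `1`). The combinations
`K^{(α)}` absorb the second term by Pascal's rule (`lenard_chain`).

*Involution.* For the same `l`, the bracket is a combination of the numbers
`tr (F_m^k [A_l, F_n^j])`; the commutation relation moves a power of `λ` from the first factor to
the second without changing the value, until the first factor is zero
(`trace_pencil_comm_eq_zero`). For different `l`, and for functions of `A_tot`, one of the gradients
is constant on all sites where the other is nonzero, and the invariance of the function under
conjugation gives zero (`pairing_stepGrad_const`). The Gel'fand–Cetlin functions commute because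
`π_m` of `X` commutes with its powers (`cornerGrad_involutive`). Involution for `R` follows, since
`R` is reduced to `P` by the recursion on chains and `R = (N - 1) P` on functions of `A_tot`.

*Independence.* In a linear relation between the differentials the components at two consecutive
sites are compared. If the matrices `F_n^k` of the pencil `λ A_l + B_l` are linearly independent
modulo scalars, then all coefficients of the relation at the site `l` agree with the coefficient of
the Casimir of the first site, and the relation becomes one in which `B_l` is replaced by
`B_l + A_l`. At the last site a relation between gradients of invariants and of Cartan and
Gel'fand–Cetlin functions of `A_tot` remains (`linearIndependent_diff_fullFamily`). The two kinds of
genericity needed are checked at single points: for the pencils, at the Jordan block and a grading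
element, where the entries of `F_n^k` along its diagonal are the values of a polynomial of degree
exactly `n - k` (`linearIndependent_pencilFamily`); for the last relation, at the Jordan block
(`linearIndependent_cetlinFamily`). The Jordan block also bounds the corank of `P`.

*Generic points.* All these conditions follow from the nonvanishing of one holomorphic function `D`
on the phase space (`exists_generic`). Its complement of zeros is dense, by restriction to complex
lines, and it is dense in each leaf that it meets, by restriction to the curves
`t ↦ (g_t A_i g_t⁻¹)_i` with `g_t = (1 - t) g + t`, which are defined on the complement of a finite
subset of `ℂ` (`leaf_subset_closure`). At a point where `D` does not vanish the Casimirs span the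
kernel of `P` for reasons of dimension, so a combination of the other functions that is constant
along the leaf is zero.
-/

namespace Gaudin

open Topology

/-! ### Coefficients of the powers of a matrix pencil -/

open Polynomial in
/-- The coefficient of `λ ^ k` in `(λ a + b) ^ n`, for matrices `a` and `b`. -/
noncomputable def pencil {r : ℕ} (a b : Matrix (Fin r) (Fin r) ℂ) (n k : ℕ) :
    Matrix (Fin r) (Fin r) ℂ :=
  ((X * C a + C b) ^ n).coeff k

/-- The coefficient of `λ ^ k` in `λ (λ a + b) ^ n`. -/
noncomputable def pencilShift {r : ℕ} (a b : Matrix (Fin r) (Fin r) ℂ) (n : ℕ) :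
    ℕ → Matrix (Fin r) (Fin r) ℂ
  | 0 => 0
  | k + 1 => pencil a b n k

section Pencil

variable {r : ℕ} (a b : Matrix (Fin r) (Fin r) ℂ)

@[simp] theorem pencilShift_zero (n : ℕ) : pencilShift a b n 0 = 0 := rfl

@[simp] theorem pencilShift_succ (n k : ℕ) : pencilShift a b n (k + 1) = pencil a b n k := rfl

theorem pencil_zero (k : ℕ) : pencil a b 0 k = if k = 0 then 1 else 0 := by
  simp [pencil, Polynomial.coeff_one]

theorem pencil_succ (n k : ℕ) :
    pencil a b (n + 1) k = a * pencilShift a b n k + b * pencil a b n k := by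
  cases k with
  | zero => simp [pencil, pow_succ', add_mul, mul_assoc]
  | succ k => simp [pencil, pow_succ', add_mul, mul_assoc, Polynomial.coeff_X_mul]

theorem pencil_succ_right (n k : ℕ) :
    pencil a b (n + 1) k = pencilShift a b n k * a + pencil a b n k * b := by
  have h : ∀ p : Polynomial (Matrix (Fin r) (Fin r) ℂ),
      p * (Polynomial.X * Polynomial.C a) = Polynomial.X * (p * Polynomial.C a) := fun p => by
    rw [← mul_assoc, ← Polynomial.X_mul, mul_assoc]
  cases k with
  | zero => simp [pencil, pow_succ, mul_add]
  | succ k =>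
    rw [pencil, pow_succ, mul_add, h, Polynomial.coeff_add, Polynomial.coeff_X_mul,
      Polynomial.coeff_mul_C, Polynomial.coeff_mul_C]
    rfl

/-- The coefficients of `[λ a + b, (λ a + b) ^ n] = 0`. -/
theorem pencil_comm (n k : ℕ) :
    a * pencilShift a b n k + b * pencil a b n k
      = pencilShift a b n k * a + pencil a b n k * b := by
  rw [← pencil_succ, ← pencil_succ_right]

theorem pencil_eq_zero {n k : ℕ} (h : n < k) : pencil a b n k = 0 := by
  induction n generalizing k with
  | zero => rw [pencil_zero, if_neg (by omega)]
  | succ n ih =>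
    cases k with
    | zero => omega
    | succ k => rw [pencil_succ, pencilShift_succ, ih (by omega), ih (by omega)]; simp

theorem pencil_self (n : ℕ) : pencil a b n n = a ^ n := by
  induction n with
  | zero => simp [pencil_zero]
  | succ n ih => rw [pencil_succ, pencilShift_succ, ih, pencil_eq_zero _ _ (Nat.lt_succ_self n),
      pow_succ', mul_zero, add_zero]

theorem pencil_coeff_zero (n : ℕ) : pencil a b n 0 = b ^ n := by
  induction n with
  | zero => simp [pencil_zero]
  | succ n ih => rw [pencil_succ, pencilShift_zero, ih, pow_succ', mul_zero, zero_add]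

/-- Multiplication by `λ` shifts the coefficients. -/
theorem sum_pow_mul_shift {M : Type*} [AddCommGroup M] [Module ℂ M] (c : ℂ) (n : ℕ)
    (u v : ℕ → M) (h0 : v 0 = 0) (h : ∀ k, v (k + 1) = u k) :
    c • ∑ k ∈ Finset.range n, c ^ k • u k = ∑ k ∈ Finset.range (n + 1), c ^ k • v k := by
  rw [Finset.sum_range_succ', h0, smul_zero, add_zero, Finset.smul_sum]
  exact Finset.sum_congr rfl fun k _ => by rw [h, smul_smul, pow_succ']

theorem sum_pencil (c : ℂ) (n : ℕ) :
    (c • a + b) ^ n = ∑ k ∈ Finset.range (n + 1), c ^ k • pencil a b n k := by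
  induction n with
  | zero => simp [pencil_zero]
  | succ n ih =>
    have h1 := sum_pow_mul_shift c (n + 1) (fun k => a * pencil a b n k)
      (fun k => a * pencilShift a b n k) (by simp) (fun k => by simp)
    have h2 : ∑ k ∈ Finset.range (n + 1), c ^ k • (b * pencil a b n k)
        = ∑ k ∈ Finset.range (n + 2), c ^ k • (b * pencil a b n k) := by
      rw [Finset.sum_range_succ _ (n + 1), pencil_eq_zero a b (Nat.lt_succ_self n)]
      simp
    simp only [pencil_succ, smul_add, Finset.sum_add_distrib]
    rw [← h1, ← h2, pow_succ', ih, add_mul, Finset.mul_sum, Finset.mul_sum, Finset.smul_sum]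
    simp [smul_smul, mul_comm]

/-- Two polynomial functions of `c` that agree everywhere have the same coefficients. -/
theorem eq_of_sum_pow_mul_eq {n : ℕ} {u v : ℕ → ℂ}
    (h : ∀ c : ℂ, ∑ k ∈ Finset.range n, c ^ k * u k = ∑ k ∈ Finset.range n, c ^ k * v k)
    {k : ℕ} (hk : k < n) : u k = v k := by
  have key : ∑ k ∈ Finset.range n, Polynomial.monomial k (u k)
      = ∑ k ∈ Finset.range n, Polynomial.monomial k (v k) := by
    refine Polynomial.funext fun c => ?_
    simpa [Polynomial.eval_finsetSum, mul_comm] using h c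
  have := congrArg (fun p => Polynomial.coeff p k) key
  simpa [Polynomial.finsetSum_coeff, Polynomial.coeff_monomial, hk] using this

end Pencil

/-! ### Derivatives of traces of powers -/

section Calculus

attribute [local instance] Matrix.linftyOpNormedRing Matrix.linftyOpNormedAlgebra

variable {E : Type*} [NormedAddCommGroup E] [NormedSpace ℂ E] {m : ℕ}

theorem differentiable_linearMap [FiniteDimensional ℂ E] {F : Type*} [NormedAddCommGroup F]
    [NormedSpace ℂ F] (f : E →ₗ[ℂ] F) : Differentiable ℂ f :=
  (LinearMap.toContinuousLinearMap f).differentiable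

theorem differentiable_linear_pencil [FiniteDimensional ℂ E] {F : Type*} [NormedAddCommGroup F]
    [NormedSpace ℂ F] (a b : E →ₗ[ℂ] Matrix (Fin m) (Fin m) ℂ)
    (f : Matrix (Fin m) (Fin m) ℂ →ₗ[ℂ] F) (n k : ℕ) :
    Differentiable ℂ fun x => f (pencil (a x) (b x) n k) := by
  refine (differentiable_linearMap f).comp ?_
  have ha : Differentiable ℂ fun x => a x := differentiable_linearMap a
  have hb : Differentiable ℂ fun x => b x := differentiable_linearMap b
  induction n generalizing k with
  | zero => simp only [pencil_zero]; exact differentiable_const _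
  | succ n ih =>
    simp only [pencil_succ]
    refine Differentiable.add (ha.mul ?_) (hb.mul (ih k))
    cases k with
    | zero => simp
    | succ k => exact ih k

/-- The derivative of `τ (M ^ n)` for a trace `τ` on a normed algebra. -/
theorem hasFDerivAt_comp_pow {𝔸 : Type*} [NormedRing 𝔸] [NormedAlgebra ℂ 𝔸] (τ : 𝔸 →L[ℂ] ℂ)
    (hτ : ∀ x y, τ (x * y) = τ (y * x)) (M : E →L[ℂ] 𝔸) (n : ℕ) (x : E) :
    HasFDerivAt (fun y => τ ((M y) ^ n))
      ((n : ℂ) • (τ ∘L ContinuousLinearMap.mul ℂ 𝔸 ((M x) ^ (n - 1)) ∘L M)) x := by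
  refine (τ.hasFDerivAt.comp x (M.hasFDerivAt.pow' n)).congr_fderiv ?_
  ext v
  simp only [ContinuousLinearMap.comp_apply, sum_apply, map_sum, smul_apply,
    ContinuousLinearMap.mul_apply']
  rw [Finset.sum_congr rfl (g := fun _ => τ (M x ^ (n - 1) * M v))]
  · simp
  · intro i hi
    have hi' := Finset.mem_range.1 hi
    simp only [MulOpposite.smul_eq_mul_unop, MulOpposite.unop_op, smul_eq_mul]
    rw [hτ, ← mul_assoc, ← pow_add]
    congr 3
    simp only [Nat.pred_eq_sub_one]
    omega

/-- `d tr (M ^ n) = n tr (M ^ (n - 1) dM)`. -/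
theorem hasFDerivAt_trace_pow [FiniteDimensional ℂ E]
    (M : E →ₗ[ℂ] Matrix (Fin m) (Fin m) ℂ) (n : ℕ) (x : E) :
    HasFDerivAt (fun y => ((M y) ^ n).trace)
      (LinearMap.toContinuousLinearMap ((n : ℂ) • (Matrix.traceLinearMap (Fin m) ℂ ℂ ∘ₗ
        LinearMap.mulLeft ℂ ((M x) ^ (n - 1)) ∘ₗ M))) x :=
  hasFDerivAt_comp_pow (LinearMap.toContinuousLinearMap (Matrix.traceLinearMap (Fin m) ℂ ℂ))
    (fun x y => Matrix.trace_mul_comm x y) (LinearMap.toContinuousLinearMap M) n x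

end Calculus

variable {N r : ℕ}

/-! ### Covectors and gradients -/

/-- The covector `V ↦ ∑ j, tr (X j * V j)` on the phase space. -/
noncomputable def trForm (X : Fin N → Matrix (Fin r) (Fin r) ℂ) : Module.Dual ℂ (Phase N r) :=
  ∑ j, Matrix.traceLinearMap (Fin r) ℂ ℂ ∘ₗ LinearMap.mulLeft ℂ (X j) ∘ₗ slIncl r ∘ₗ
    LinearMap.proj j

theorem trForm_apply (X : Fin N → Matrix (Fin r) (Fin r) ℂ) (V : Phase N r) :
    trForm X V = ∑ j, (X j * (V j).val).trace := by
  simp [trForm, slIncl]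

theorem trace_mul_tracelessPart (X Y : Matrix (Fin r) (Fin r) ℂ) :
    (X * tracelessPart Y).trace = (tracelessPart X * Y).trace := by
  simp only [tracelessPart, mul_sub, sub_mul, Matrix.trace_sub, Matrix.mul_smul, Matrix.smul_mul,
    mul_one, one_mul, Matrix.trace_smul, smul_eq_mul]
  ring

theorem sl_trace (X : Sl r) : X.val.trace = 0 := X.2

theorem tracelessPart_of_trace_eq_zero {X : Matrix (Fin r) (Fin r) ℂ} (h : X.trace = 0) :
    tracelessPart X = X := by
  simp [tracelessPart, h]

@[simp] theorem toSl_val (X : Matrix (Fin r) (Fin r) ℂ) : (toSl X).val = tracelessPart X := rfl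

theorem trace_mul_single (X : Matrix (Fin r) (Fin r) ℂ) (a b : Fin r) :
    (X * Matrix.single b a 1).trace = X a b := by
  rw [Matrix.trace_mul_single]; simp

theorem comp_trForm (X : Fin N → Matrix (Fin r) (Fin r) ℂ) (j : Fin N) :
    comp (trForm X) j = toSl (X j) := by
  apply Subtype.ext
  ext a b
  change trForm X (Pi.single j (toSl (Matrix.single b a 1))) = tracelessPart (X j) a b
  rw [trForm_apply, Finset.sum_eq_single j]
  · rw [Pi.single_eq_same, toSl_val, trace_mul_tracelessPart, trace_mul_single]
  · intro i _ hi
    simp [Pi.single_eq_of_ne hi]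
  · simp

theorem lie_toSl_val (A : Sl r) (X : Matrix (Fin r) (Fin r) ℂ) :
    (⁅A, toSl X⁆ : Sl r).val = A.val * X - X * A.val := by
  rw [LieAlgebra.SpecialLinear.sl_bracket, toSl_val, tracelessPart]
  simp [mul_sub, sub_mul]

theorem sum_coe {ι : Type*} (s : Finset ι) (f : ι → Sl r) :
    (∑ i ∈ s, f i).val = ∑ i ∈ s, (f i).val := map_sum (slIncl r) f s

theorem blockTensor_trForm (c : Fin N → Fin N → Sl r) (X : Fin N → Matrix (Fin r) (Fin r) ℂ)
    (i : Fin N) :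
    (blockTensor c (trForm X) i).val = ∑ j, ((c i j).val * X j - X j * (c i j).val) := by
  change (∑ j, ⁅c i j, comp (trForm X) j⁆ : Sl r).val = _
  rw [sum_coe]
  exact Finset.sum_congr rfl fun j _ => by rw [comp_trForm, lie_toSl_val]

theorem tensorP_trForm (A : Phase N r) (X : Fin N → Matrix (Fin r) (Fin r) ℂ) (i : Fin N) :
    (tensorP A (trForm X) i).val = (A i).val * X i - X i * (A i).val := by
  rw [tensorP, blockTensor_trForm, Finset.sum_eq_single i]
  · simp
  · intro j _ hj
    simp [if_neg hj.symm]
  · simp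

theorem tensorP_apply (A : Phase N r) (ξ : Module.Dual ℂ (Phase N r)) (i : Fin N) :
    tensorP A ξ i = ⁅A i, comp ξ i⁆ := by
  change (∑ j, ⁅(if i = j then A i else 0 : Sl r), comp ξ j⁆ : Sl r) = _
  rw [Finset.sum_eq_single i]
  · simp
  · intro j _ hj
    simp [if_neg hj.symm]
  · simp

/-- Every covector is given by its components. -/
theorem trForm_comp (ξ : Module.Dual ℂ (Phase N r)) : trForm (fun j => (comp ξ j).val) = ξ := by
  ext j V
  simp only [LinearMap.comp_apply]
  rw [trForm_apply, Finset.sum_eq_single j]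
  · rw [LinearMap.single_apply, Pi.single_eq_same, comp, trace_traceDual_mul]
    rfl
  · intro i _ hi
    simp [Pi.single_eq_of_ne hi]
  · simp

theorem comp_add (ξ η : Module.Dual ℂ (Phase N r)) (j : Fin N) :
    comp (ξ + η) j = comp ξ j + comp η j := by
  unfold comp; rw [LinearMap.add_comp, traceDual_add]

theorem comp_smul (a : ℂ) (ξ : Module.Dual ℂ (Phase N r)) (j : Fin N) :
    comp (a • ξ) j = a • comp ξ j := by
  unfold comp; rw [LinearMap.smul_comp, traceDual_smul]

/-- The `j`-th component of a covector, as a linear map. -/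
noncomputable def compLin (j : Fin N) : Module.Dual ℂ (Phase N r) →ₗ[ℂ] Sl r where
  toFun ξ := comp ξ j
  map_add' ξ η := comp_add ξ η j
  map_smul' a ξ := comp_smul a ξ j

/-- `F` has at `A` the differential with the components `X j` (modulo scalar matrices). -/
def HasGrad (F : Phase N r → ℂ) (X : Fin N → Matrix (Fin r) (Fin r) ℂ) (A : Phase N r) : Prop :=
  HasFDerivAt F (LinearMap.toContinuousLinearMap (trForm X)) A

theorem HasGrad.diff {F : Phase N r → ℂ} {X : Fin N → Matrix (Fin r) (Fin r) ℂ} {A : Phase N r}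
    (h : HasGrad F X A) : diff F A = trForm X := by
  unfold Gaudin.diff
  rw [HasFDerivAt.fderiv h]
  rfl

theorem HasGrad.of_eq {F : Phase N r → ℂ} {L : Module.Dual ℂ (Phase N r)} {A : Phase N r}
    (h : HasFDerivAt F (LinearMap.toContinuousLinearMap L) A)
    {X : Fin N → Matrix (Fin r) (Fin r) ℂ} (hX : ∀ V, L V = ∑ j, (X j * (V j).val).trace) :
    HasGrad F X A := by
  have : L = trForm X := LinearMap.ext fun V => by rw [hX, trForm_apply]
  rw [HasGrad, ← this]
  exact h

/-- The pairing of two covectors under `P`. -/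
theorem trForm_tensorP_trForm (A : Phase N r) (X Y : Fin N → Matrix (Fin r) (Fin r) ℂ) :
    trForm X (tensorP A (trForm Y))
      = ∑ i, (X i * ((A i).val * Y i - Y i * (A i).val)).trace := by
  rw [trForm_apply]
  exact Finset.sum_congr rfl fun i _ => by rw [tensorP_trForm]

/-- `P` is antisymmetric. -/
theorem pairing_antisymm (A : Phase N r) (ξ η : Module.Dual ℂ (Phase N r)) :
    ξ (tensorP A η) = - η (tensorP A ξ) := by
  rw [← trForm_comp ξ, ← trForm_comp η, trForm_tensorP_trForm, trForm_tensorP_trForm,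
    ← Finset.sum_neg_distrib]
  refine Finset.sum_congr rfl fun i _ => ?_
  generalize (comp ξ i).val = X
  generalize (comp η i).val = Y
  rw [mul_sub, mul_sub, Matrix.trace_sub, Matrix.trace_sub,
    show (X * ((A i).val * Y)).trace = (Y * (X * (A i).val)).trace from
      Matrix.trace_mul_cycle' _ _ _,
    show (Y * ((A i).val * X)).trace = (X * (Y * (A i).val)).trace from
      Matrix.trace_mul_cycle' _ _ _]
  ring

theorem partialSum_val (A : Phase N r) (l : Fin N) :
    (partialSum A l).val = ∑ i ∈ Finset.univ.filter (· < l), (A i).val := sum_coe _ _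

/-- `A ↦ A_i` as a linear map to matrices. -/
noncomputable def siteLin (i : Fin N) : Phase N r →ₗ[ℂ] Matrix (Fin r) (Fin r) ℂ :=
  slIncl r ∘ₗ LinearMap.proj i

/-- `A ↦ B_l` as a linear map to matrices. -/
noncomputable def partialSumLin (l : Fin N) : Phase N r →ₗ[ℂ] Matrix (Fin r) (Fin r) ℂ :=
  ∑ i ∈ Finset.univ.filter (· < l), siteLin i

theorem partialSumLin_apply (l : Fin N) (A : Phase N r) :
    partialSumLin l A = (partialSum A l).val := by
  rw [partialSum_val, partialSumLin, LinearMap.sum_apply]; rfl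

theorem siteLin_apply (i : Fin N) (A : Phase N r) : siteLin i A = (A i).val := rfl

theorem lenardH_eq (α β : ℕ) (l : Fin N) (A : Phase N r) :
    lenardH α β l A = (pencil (A l).val (partialSum A l).val β α).trace := rfl

theorem differentiable_lenardH (α β : ℕ) (l : Fin N) :
    Differentiable ℂ (lenardH α β l : Phase N r → ℂ) := by
  have h := differentiable_linear_pencil (siteLin (r := r) l) (partialSumLin l)
    (Matrix.traceLinearMap (Fin r) ℂ ℂ) β α
  simp only [partialSumLin_apply] at h
  exact h

/-- The gradient of `H^{(α)}_{β,l}`. For `β = 0` the exponent `β - 1` is truncated, which the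
factor `β` makes harmless. -/
noncomputable def gradH (α β : ℕ) (l : Fin N) (A : Phase N r) (j : Fin N) :
    Matrix (Fin r) (Fin r) ℂ :=
  if j < l then (β : ℂ) • pencil (A l).val (partialSum A l).val (β - 1) α
  else if j = l then (β : ℂ) • pencilShift (A l).val (partialSum A l).val (β - 1) α
  else 0

theorem sum_split {M : Type*} [AddCommMonoid M] (l : Fin N) (f g h : Fin N → M)
    (h1 : ∀ j, j < l → f j = g j) (h2 : f l = h l) (h3 : ∀ j, l < j → f j = 0) :
    ∑ j, f j = ∑ j ∈ Finset.univ.filter (· < l), g j + h l := by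
  rw [← Finset.sum_filter_add_sum_filter_not Finset.univ (· < l) f]
  congr 1
  · exact Finset.sum_congr rfl fun j hj => h1 j (Finset.mem_filter.1 hj).2
  · rw [Finset.sum_eq_single l, h2]
    · intro j hj hjl
      exact h3 j (lt_of_le_of_ne (not_lt.1 (Finset.mem_filter.1 hj).2) (Ne.symm hjl))
    · intro h; simp at h

theorem gradH_of_lt {α β : ℕ} {l j : Fin N} (A : Phase N r) (h : j < l) :
    gradH α β l A j = (β : ℂ) • pencil (A l).val (partialSum A l).val (β - 1) α := if_pos h

theorem gradH_self (α β : ℕ) (l : Fin N) (A : Phase N r) :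
    gradH α β l A l = (β : ℂ) • pencilShift (A l).val (partialSum A l).val (β - 1) α := by
  simp [gradH]

theorem gradH_of_gt {α β : ℕ} {l j : Fin N} (A : Phase N r) (h : l < j) :
    gradH α β l A j = 0 := by
  simp [gradH, h.not_gt, h.ne']

theorem sum_gradH_mul (α β : ℕ) (l : Fin N) (A V : Phase N r) :
    ∑ j, (gradH α β l A j * (V j).val).trace
      = (β : ℂ) * ((pencil (A l).val (partialSum A l).val (β - 1) α * (partialSum V l).val).trace
        + (pencilShift (A l).val (partialSum A l).val (β - 1) α * (V l).val).trace) := by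
  rw [sum_split l _ (fun j => ((β : ℂ) • pencil (A l).val (partialSum A l).val (β - 1) α
    * (V j).val).trace) (fun j => (gradH α β l A j * (V j).val).trace)
    (fun j hj => by rw [gradH_of_lt A hj]) rfl (fun j hj => by rw [gradH_of_gt A hj]; simp),
    gradH_self, ← Matrix.trace_sum, ← Finset.mul_sum, ← partialSum_val]
  simp [mul_add]

/-- The gradient is found by comparing the coefficients in the derivative of
`tr (λ A_l + B_l) ^ β`. -/
theorem hasGrad_lenardH (α β : ℕ) (l : Fin N) (A : Phase N r) :
    HasGrad (lenardH α β l) (gradH α β l A) A := by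
  have hd := (differentiable_lenardH α β l A).hasFDerivAt
  refine HasGrad.of_eq (L := (fderiv ℂ (lenardH α β l) A).toLinearMap) hd fun V => ?_
  rw [sum_gradH_mul]
  by_cases hαβ : β < α
  · have h0 : (lenardH α β l : Phase N r → ℂ) = fun _ => 0 := by
      funext A; rw [lenardH_eq, pencil_eq_zero _ _ hαβ, Matrix.trace_zero]
    obtain ⟨α, rfl⟩ : ∃ a, α = a + 1 := ⟨α - 1, by omega⟩
    rw [h0, pencil_eq_zero _ _ (show β - 1 < α + 1 by omega), pencilShift_succ]
    rcases Nat.eq_zero_or_pos β with rfl | hβ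
    · simp
    · rw [pencil_eq_zero _ _ (show β - 1 < α by omega)]; simp
  rcases β with _ | n
  · have h0 : (lenardH α 0 l : Phase N r → ℂ) = fun _ => (if α = 0 then (1 : Matrix (Fin r)
        (Fin r) ℂ) else 0).trace := by
      funext A; rw [lenardH_eq, pencil_zero]
    rw [h0]; simp
  refine eq_of_sum_pow_mul_eq (n := n + 2) (u := fun k => fderiv ℂ (lenardH k (n + 1) l) A V)
    (v := fun k => ((n + 1 : ℕ) : ℂ) * ((pencil (A l).val (partialSum A l).val (n + 1 - 1) k *
      (partialSum V l).val).trace + (pencilShift (A l).val (partialSum A l).val (n + 1 - 1) k *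
      (V l).val).trace)) (fun c => ?_) (k := α) (by omega)
  have hF : (fun A : Phase N r => ((c • siteLin l A + partialSumLin l A) ^ (n + 1)).trace)
      = fun A => ∑ k ∈ Finset.range (n + 2), c ^ k * lenardH k (n + 1) l A := by
    funext A
    rw [sum_pencil, Matrix.trace_sum]
    refine Finset.sum_congr rfl fun k _ => ?_
    rw [Matrix.trace_smul, partialSumLin_apply]; rfl
  have h1 := hasFDerivAt_trace_pow (c • siteLin (r := r) l + partialSumLin l) (n + 1) A
  have h2 : HasFDerivAt (fun A => ∑ k ∈ Finset.range (n + 2), c ^ k * lenardH k (n + 1) l A)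
      (∑ k ∈ Finset.range (n + 2), c ^ k • fderiv ℂ (lenardH k (n + 1) l) A) A :=
    HasFDerivAt.fun_sum fun k _ =>
      (differentiable_lenardH k (n + 1) l A).hasFDerivAt.const_mul (c ^ k)
  rw [← hF] at h2
  have h3 := congrArg (fun L => L V) (h2.unique h1)
  simp only [sum_apply, smul_apply, smul_eq_mul] at h3
  refine h3.trans ?_
  simp only [LinearMap.coe_toContinuousLinearMap', LinearMap.smul_apply, LinearMap.comp_apply,
    LinearMap.add_apply, partialSumLin_apply, siteLin_apply, Matrix.traceLinearMap_apply,
    LinearMap.mulLeft_apply, smul_eq_mul, Nat.add_sub_cancel]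
  have hl := sum_pow_mul_shift c (n + 1)
    (fun k => (pencil (A l).val (partialSum A l).val n k * (V l).val).trace)
    (fun k => (pencilShift (A l).val (partialSum A l).val n k * (V l).val).trace)
    (by simp) (fun k => by simp)
  have hb : ∑ k ∈ Finset.range (n + 1),
        c ^ k * (pencil (A l).val (partialSum A l).val n k * (partialSum V l).val).trace
      = ∑ k ∈ Finset.range (n + 2),
        c ^ k * (pencil (A l).val (partialSum A l).val n k * (partialSum V l).val).trace := by
    rw [Finset.sum_range_succ _ (n + 1), pencil_eq_zero _ _ (Nat.lt_succ_self n)]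
    simp
  simp only [smul_eq_mul] at hl
  simp only [mul_left_comm _ ((n + 1 : ℕ) : ℂ), ← Finset.mul_sum, mul_add,
    Finset.sum_add_distrib]
  rw [← hb, ← hl, sum_pencil, ← mul_add]
  simp [mul_add, Finset.sum_mul, Finset.mul_sum, Matrix.trace_sum, mul_left_comm, add_comm]

theorem diff_lenardH (α β : ℕ) (l : Fin N) (A : Phase N r) :
    diff (lenardH α β l) A = trForm (gradH α β l A) := (hasGrad_lenardH α β l A).diff

theorem casimir_eq (β : ℕ) (l : Fin N) : (casimir β l : Phase N r → ℂ) = lenardH β β l := by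
  funext A; rw [lenardH_eq, pencil_self]; rfl

/-! ### The Lenard recursion and involution of the chain Hamiltonians -/

theorem tensorR_trForm (A : Phase N r) (X : Fin N → Matrix (Fin r) (Fin r) ℂ) (i : Fin N) :
    (tensorR A (trForm X) i).val
      = ∑ j, (((if i = j then (i.val : ℂ) • A i - partialSum A i else A (min i j) : Sl r)).val
          * X j - X j *
          ((if i = j then (i.val : ℂ) • A i - partialSum A i else A (min i j) : Sl r)).val) :=
  blockTensor_trForm _ _ _

/-- The `i`-th component of `R ξ`, sorted by the position of the summation index. -/
theorem tensorR_trForm' (A : Phase N r) (X : Fin N → Matrix (Fin r) (Fin r) ℂ) (i : Fin N) :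
    (tensorR A (trForm X) i).val
      = ∑ j ∈ Finset.univ.filter (· < i), ((A j).val * X j - X j * (A j).val)
        + (((i.val : ℂ) • (A i).val - (partialSum A i).val) * X i
            - X i * ((i.val : ℂ) • (A i).val - (partialSum A i).val))
        + ∑ j ∈ Finset.univ.filter (i < ·), ((A i).val * X j - X j * (A i).val) := by
  rw [tensorR_trForm, ← Finset.sum_filter_add_sum_filter_not Finset.univ (i < ·), add_comm]
  congr 1
  · have hset : Finset.univ.filter (fun j => ¬ i < j)
        = insert i (Finset.univ.filter (· < i)) := by
      ext j
      simp [le_iff_eq_or_lt]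
    rw [hset, Finset.sum_insert (by simp), add_comm]
    congr 1
    · refine Finset.sum_congr rfl fun j hj => ?_
      have h := (Finset.mem_filter.1 hj).2
      rw [if_neg h.ne', min_eq_right h.le]
    · rw [if_pos rfl]; rfl
  · refine Finset.sum_congr rfl fun j hj => ?_
    have h := (Finset.mem_filter.1 hj).2
    rw [if_neg h.ne, min_eq_left h.le]

theorem sum_sub_comm (s : Finset (Fin N)) (A : Phase N r) (Y : Matrix (Fin r) (Fin r) ℂ) :
    ∑ j ∈ s, ((A j).val * Y - Y * (A j).val)
      = (∑ j ∈ s, (A j).val) * Y - Y * ∑ j ∈ s, (A j).val := by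
  rw [Finset.sum_sub_distrib, Finset.sum_mul, Finset.mul_sum]

/-- A gradient that vanishes after the site `l` and is constant before it. -/
def stepGrad (l : Fin N) (Y Z : Matrix (Fin r) (Fin r) ℂ) (j : Fin N) :
    Matrix (Fin r) (Fin r) ℂ :=
  if j < l then Y else if j = l then Z else 0

theorem stepGrad_of_lt {l j : Fin N} (Y Z : Matrix (Fin r) (Fin r) ℂ) (h : j < l) :
    stepGrad l Y Z j = Y := if_pos h

theorem stepGrad_self (l : Fin N) (Y Z : Matrix (Fin r) (Fin r) ℂ) :
    stepGrad l Y Z l = Z := by simp [stepGrad]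

theorem stepGrad_of_gt {l j : Fin N} (Y Z : Matrix (Fin r) (Fin r) ℂ) (h : l < j) :
    stepGrad l Y Z j = 0 := by simp [stepGrad, h.not_gt, h.ne']

theorem gradH_eq_stepGrad (α β : ℕ) (l : Fin N) (A : Phase N r) :
    gradH α β l A = stepGrad l ((β : ℂ) • pencil (A l).val (partialSum A l).val (β - 1) α)
      ((β : ℂ) • pencilShift (A l).val (partialSum A l).val (β - 1) α) := rfl

theorem sum_stepGrad_comm_of_lt {i l : Fin N} (h : l < i) (A : Phase N r)
    (Y Z : Matrix (Fin r) (Fin r) ℂ) :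
    ∑ j ∈ Finset.univ.filter (· < i),
        ((A j).val * stepGrad l Y Z j - stepGrad l Y Z j * (A j).val)
      = (partialSum A l).val * Y - Y * (partialSum A l).val
        + ((A l).val * Z - Z * (A l).val) := by
  rw [Finset.sum_filter, sum_split l _ (fun j => (A j).val * Y - Y * (A j).val)
    (fun _ => (A l).val * Z - Z * (A l).val), sum_sub_comm, partialSum_val]
  · intro j hj
    rw [if_pos (hj.trans h), stepGrad_of_lt _ _ hj]
  · rw [if_pos h, stepGrad_self]
  · intro j hj
    rw [stepGrad_of_gt _ _ hj]; simp

theorem card_filter_between (i l : Fin N) :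
    (Finset.univ.filter (fun j : Fin N => i < j ∧ j < l)).card = l.val - i.val - 1 := by
  have : Finset.univ.filter (fun j : Fin N => i < j ∧ j < l) = Finset.Ioo i l := by
    ext j; simp
  rw [this, Fin.card_Ioo]

/-- `R` on a step gradient. If `Y, Z, W` are consecutive terms of a sequence obeying the
commutation relation of the pencil coefficients, `[A_l, Z] + [B_l, Y] = 0` and
`[A_l, W] + [B_l, Z] = 0`, then `R` is expressed through `P` and the shifted step gradient. -/
theorem tensorR_stepGrad (A : Phase N r) (l : Fin N) (Y Z W : Matrix (Fin r) (Fin r) ℂ)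
    (hYZ : (A l).val * Z + (partialSum A l).val * Y = Z * (A l).val + Y * (partialSum A l).val)
    (hZW : (A l).val * W + (partialSum A l).val * Z = W * (A l).val + Z * (partialSum A l).val) :
    tensorR A (trForm (stepGrad l Y Z))
      = tensorP A (trForm (stepGrad l Z W))
        + ((l.val : ℂ) - 1) • tensorP A (trForm (stepGrad l Y Z)) := by
  funext i
  apply Subtype.ext
  change _ = (tensorP A (trForm (stepGrad l Z W)) i).val
    + ((l.val : ℂ) - 1) • (tensorP A (trForm (stepGrad l Y Z)) i).val
  rw [tensorR_trForm', tensorP_trForm, tensorP_trForm]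
  rcases lt_trichotomy i l with h | h | h
  · have h1 : ∑ j ∈ Finset.univ.filter (· < i),
        ((A j).val * stepGrad l Y Z j - stepGrad l Y Z j * (A j).val)
        = (partialSum A i).val * Y - Y * (partialSum A i).val := by
      rw [partialSum_val, ← sum_sub_comm]
      refine Finset.sum_congr rfl fun j hj => ?_
      rw [stepGrad_of_lt _ _ ((Finset.mem_filter.1 hj).2.trans h)]
    have h2 : ∑ j ∈ Finset.univ.filter (i < ·),
        ((A i).val * stepGrad l Y Z j - stepGrad l Y Z j * (A i).val)
        = ((l.val : ℂ) - i.val - 1) • ((A i).val * Y - Y * (A i).val)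
          + ((A i).val * Z - Z * (A i).val) := by
      rw [Finset.sum_filter, sum_split l _
        (fun j => if i < j then (A i).val * Y - Y * (A i).val else 0)
        (fun _ => (A i).val * Z - Z * (A i).val), ← Finset.sum_filter, Finset.filter_filter,
        Finset.sum_const]
      · congr 1
        rw [show (Finset.univ.filter fun a : Fin N => a < l ∧ i < a)
          = Finset.univ.filter (fun j : Fin N => i < j ∧ j < l) by
            ext; simp [and_comm], card_filter_between, ← Nat.cast_smul_eq_nsmul ℂ]
        congr 1
        have : i.val < l.val := h
        rw [Nat.sub_sub, Nat.cast_sub (by omega)]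
        push_cast; ring
      · intro j hj
        rw [stepGrad_of_lt _ _ hj]
      · rw [if_pos h, stepGrad_self]
      · intro j hj
        rw [stepGrad_of_gt _ _ hj]; simp
    rw [h1, h2, stepGrad_of_lt _ _ h, stepGrad_of_lt _ _ h]
    simp only [sub_mul, mul_sub, Matrix.smul_mul, Matrix.mul_smul]
    module
  · subst h
    have h1 : ∑ j ∈ Finset.univ.filter (· < i),
        ((A j).val * stepGrad i Y Z j - stepGrad i Y Z j * (A j).val)
        = (partialSum A i).val * Y - Y * (partialSum A i).val := by
      rw [partialSum_val, ← sum_sub_comm]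
      refine Finset.sum_congr rfl fun j hj => ?_
      rw [stepGrad_of_lt _ _ (Finset.mem_filter.1 hj).2]
    have h2 : ∑ j ∈ Finset.univ.filter (i < ·),
        ((A i).val * stepGrad i Y Z j - stepGrad i Y Z j * (A i).val) = 0 := by
      refine Finset.sum_eq_zero fun j hj => ?_
      rw [stepGrad_of_gt _ _ (Finset.mem_filter.1 hj).2]; simp
    rw [h1, h2, stepGrad_self, stepGrad_self]
    have e1 : (partialSum A i).val * Y - Y * (partialSum A i).val
        = Z * (A i).val - (A i).val * Z := by
      rw [sub_eq_sub_iff_add_eq_add, add_comm, hYZ, add_comm]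
    have e2 : (A i).val * W - W * (A i).val
        = Z * (partialSum A i).val - (partialSum A i).val * Z := by
      rw [sub_eq_sub_iff_add_eq_add, hZW, add_comm]
    rw [e1, e2]
    simp only [sub_mul, mul_sub, Matrix.smul_mul, Matrix.mul_smul]
    module
  · have h2 : ∑ j ∈ Finset.univ.filter (i < ·),
        ((A i).val * stepGrad l Y Z j - stepGrad l Y Z j * (A i).val) = 0 := by
      refine Finset.sum_eq_zero fun j hj => ?_
      rw [stepGrad_of_gt _ _ (h.trans (Finset.mem_filter.1 hj).2)]; simp
    rw [sum_stepGrad_comm_of_lt h, h2, stepGrad_of_gt _ _ h, stepGrad_of_gt _ _ h]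
    have : (partialSum A l).val * Y - Y * (partialSum A l).val
        + ((A l).val * Z - Z * (A l).val) = 0 := by
      rw [sub_add_sub_comm, sub_eq_zero, add_comm, hYZ, add_comm]
    rw [this]; simp

/-- The Lenard recursion `R dH^{(α+1)} = P dH^{(α)} + (l - 1) P dH^{(α+1)}` (sites counted
from `0`). -/
theorem tensorR_diff_lenardH_succ (α β : ℕ) (l : Fin N) (A : Phase N r) :
    tensorR A (diff (lenardH (α + 1) β l) A)
      = tensorP A (diff (lenardH α β l) A)
        + ((l.val : ℂ) - 1) • tensorP A (diff (lenardH (α + 1) β l) A) := by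
  simp only [diff_lenardH, gradH_eq_stepGrad, pencilShift_succ]
  have h := pencil_comm (A l).val (partialSum A l).val (β - 1)
  refine tensorR_stepGrad A l _ _ _ ?_ ?_
  · simpa [← smul_add] using congrArg ((β : ℂ) • ·) (h (α + 1))
  · simpa [← smul_add] using congrArg ((β : ℂ) • ·) (h α)

theorem tensorR_diff_lenardH_zero (β : ℕ) (l : Fin N) (A : Phase N r) :
    tensorR A (diff (lenardH 0 β l) A)
      = ((l.val : ℂ) - 1) • tensorP A (diff (lenardH 0 β l) A) := by
  simp only [diff_lenardH, gradH_eq_stepGrad, pencilShift_zero, smul_zero]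
  have h := pencil_comm (A l).val (partialSum A l).val (β - 1) 0
  rw [tensorR_stepGrad A l _ 0 0]
  · have : stepGrad l (0 : Matrix (Fin r) (Fin r) ℂ) 0 = 0 := by
      funext j; simp [stepGrad]
    have h0 : (trForm (0 : Fin N → Matrix (Fin r) (Fin r) ℂ)) = 0 := by
      ext; simp [trForm_apply]
    rw [this, h0, map_zero, zero_add]
  · simpa [← smul_add] using congrArg ((β : ℂ) • ·) h
  · simp

theorem trForm_tensorP_stepGrad (A : Phase N r) (l : Fin N) (Y Z : Matrix (Fin r) (Fin r) ℂ)
    (X : Fin N → Matrix (Fin r) (Fin r) ℂ) :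
    trForm (stepGrad l Y Z) (tensorP A (trForm X))
      = ∑ i ∈ Finset.univ.filter (· < l), (Y * ((A i).val * X i - X i * (A i).val)).trace
        + (Z * ((A l).val * X l - X l * (A l).val)).trace := by
  rw [trForm_tensorP_trForm, sum_split l _
    (fun i => (Y * ((A i).val * X i - X i * (A i).val)).trace)
    (fun i => (Z * ((A i).val * X i - X i * (A i).val)).trace)]
  · intro j hj; rw [stepGrad_of_lt _ _ hj]
  · rw [stepGrad_self]
  · intro j hj; rw [stepGrad_of_gt _ _ hj]; simp

/-- A function of `A_l` and `B_l` that is invariant under simultaneous conjugation commutes with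
all functions whose gradient is constant on the sites up to `l`. -/
theorem pairing_stepGrad_const (A : Phase N r) (l : Fin N) (Y Z W : Matrix (Fin r) (Fin r) ℂ)
    (hYZ : (A l).val * Z + (partialSum A l).val * Y = Z * (A l).val + Y * (partialSum A l).val)
    (X : Fin N → Matrix (Fin r) (Fin r) ℂ) (hX : ∀ i ≤ l, X i = W) :
    trForm (stepGrad l Y Z) (tensorP A (trForm X)) = 0 := by
  rw [trForm_tensorP_stepGrad, hX l le_rfl, Finset.sum_congr rfl
    (g := fun i => (Y * ((A i).val * W - W * (A i).val)).trace)
    (fun i hi => by rw [hX i (Finset.mem_filter.1 hi).2.le]), ← Matrix.trace_sum,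
    ← Finset.mul_sum, sum_sub_comm, ← partialSum_val]
  generalize (partialSum A l).val = b at *
  generalize (A l).val = a at *
  have h : ∀ U V : Matrix (Fin r) (Fin r) ℂ,
      (U * (V * W - W * V)).trace = ((U * V - V * U) * W).trace := fun U V => by
    rw [mul_sub, sub_mul, Matrix.trace_sub, Matrix.trace_sub, mul_assoc, mul_assoc,
      Matrix.trace_mul_cycle' V U W, Matrix.trace_mul_cycle' W V U]
  rw [h, h, ← Matrix.trace_add, ← add_mul,
    show Y * b - b * Y + (Z * a - a * Z) = (Z * a + Y * b) - (a * Z + b * Y) by abel, hYZ,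
    sub_self, zero_mul, Matrix.trace_zero]

theorem pairing_gradH_const (α β : ℕ) (l : Fin N) (A : Phase N r)
    (W : Matrix (Fin r) (Fin r) ℂ) (X : Fin N → Matrix (Fin r) (Fin r) ℂ)
    (hX : ∀ i ≤ l, X i = W) :
    trForm (gradH α β l A) (tensorP A (trForm X)) = 0 := by
  rw [gradH_eq_stepGrad]
  refine pairing_stepGrad_const A l _ _ W ?_ X hX
  simpa [← smul_add] using
    congrArg ((β : ℂ) • ·) (pencil_comm (A l).val (partialSum A l).val (β - 1) α)

/-- Coefficients of powers of the same pencil are in involution with respect to the bracket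
twisted by `a`. -/
theorem trace_pencil_comm_eq_zero (a b : Matrix (Fin r) (Fin r) ℂ) (m n k j : ℕ) :
    (pencil a b m k * (a * pencil a b n j - pencil a b n j * a)).trace = 0 := by
  have hc : ∀ n k, b * pencil a b n k - pencil a b n k * b
      = -(a * pencilShift a b n k - pencilShift a b n k * a) := fun n k => by
    have := pencil_comm a b n k
    rw [← sub_eq_zero] at this ⊢
    rw [← this]; abel
  have ht : ∀ U V W : Matrix (Fin r) (Fin r) ℂ,
      (U * (V * W - W * V)).trace = -((V * U - U * V) * W).trace := fun U V W => by
    rw [mul_sub, sub_mul, Matrix.trace_sub, Matrix.trace_sub, mul_assoc, mul_assoc,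
      Matrix.trace_mul_cycle' V U W, Matrix.trace_mul_cycle' W V U, neg_sub]
  -- Moving one power of `λ` from the first pencil to the second does not change the trace.
  have key : ∀ k j, (pencil a b m k * (a * pencil a b n j - pencil a b n j * a)).trace
      = (pencilShift a b m k
          * (a * pencil a b n (j + 1) - pencil a b n (j + 1) * a)).trace := fun k j => by
    have h1 : a * pencil a b n j - pencil a b n j * a
        = -(b * pencil a b n (j + 1) - pencil a b n (j + 1) * b) := by
      rw [hc n (j + 1), neg_neg, pencilShift_succ]
    rw [h1, mul_neg, Matrix.trace_neg, ht, hc m k, ht, neg_neg, neg_mul, Matrix.trace_neg]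
  induction k generalizing j with
  | zero => rw [key]; simp
  | succ k ih => rw [key, pencilShift_succ, ih]

theorem pairing_gradH_gradH (α β α' β' : ℕ) (l l' : Fin N) (A : Phase N r) :
    trForm (gradH α β l A) (tensorP A (trForm (gradH α' β' l' A))) = 0 := by
  rcases lt_trichotomy l l' with h | h | h
  · exact pairing_gradH_const α β l A _ _ fun i hi => gradH_of_lt A (hi.trans_lt h)
  · subst h
    rw [gradH_eq_stepGrad, trForm_tensorP_stepGrad, gradH_self]
    have h1 : ∀ i ∈ Finset.univ.filter (· < l),
        (((β : ℂ) • pencil (A l).val (partialSum A l).val (β - 1) α)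
          * ((A i).val * gradH α' β' l A i - gradH α' β' l A i * (A i).val)).trace
        = (((β : ℂ) • pencil (A l).val (partialSum A l).val (β - 1) α)
          * ((A i).val * ((β' : ℂ) • pencil (A l).val (partialSum A l).val (β' - 1) α')
            - ((β' : ℂ) • pencil (A l).val (partialSum A l).val (β' - 1) α')
              * (A i).val)).trace := fun i hi => by
      rw [gradH_of_lt A (Finset.mem_filter.1 hi).2]
    rw [Finset.sum_congr rfl h1, ← Matrix.trace_sum, ← Finset.mul_sum, sum_sub_comm,
      ← partialSum_val]
    simp only [Matrix.mul_smul, Matrix.smul_mul, ← smul_sub, Matrix.trace_smul]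
    have hc := pencil_comm (A l).val (partialSum A l).val (β' - 1) α'
    have ht := fun k j =>
      trace_pencil_comm_eq_zero (A l).val (partialSum A l).val (β - 1) (β' - 1) k j
    generalize (partialSum A l).val = b at *
    generalize (A l).val = a at *
    have h2 : b * pencil a b (β' - 1) α' - pencil a b (β' - 1) α' * b
        = -(a * pencilShift a b (β' - 1) α' - pencilShift a b (β' - 1) α' * a) := by
      rw [← sub_eq_zero] at hc ⊢
      rw [← hc]; abel
    rw [h2]
    rcases α' with _ | α'
    · simp
    · rcases α with _ | α
      · simp [-neg_sub, ht]
      · simp [-neg_sub, ht]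
  · rw [pairing_antisymm, pairing_gradH_const α' β' l' A _ _ fun i hi =>
      gradH_of_lt A (hi.trans_lt h), neg_zero]

/-! ### The Lenard chains -/

theorem tensorP_diff_casimir (β : ℕ) (l : Fin N) (A : Phase N r) :
    tensorP A (diff (lenardH β β l) A) = 0 := by
  rw [diff_lenardH]
  funext i
  apply Subtype.ext
  rw [tensorP_trForm]
  change _ = (0 : Matrix (Fin r) (Fin r) ℂ)
  rcases β with _ | β
  · simp [gradH]
  rcases lt_trichotomy i l with h | rfl | h
  · rw [gradH_of_lt A h, pencil_eq_zero _ _ (by omega)]; simp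
  · rw [gradH_self, pencilShift_succ, Nat.add_sub_cancel, pencil_self, Matrix.mul_smul,
      Matrix.smul_mul, ← pow_succ, ← pow_succ', sub_self]
  · rw [gradH_of_gt A h]; simp

theorem tensorR_diff_casimir (β : ℕ) (l : Fin N) (hl : l.val = 0) (A : Phase N r) :
    tensorR A (diff (lenardH β β l) A) = 0 := by
  rcases β with _ | β
  · rw [tensorR_diff_lenardH_zero, tensorP_diff_casimir, smul_zero]
  · rw [tensorR_diff_lenardH_succ, tensorP_diff_casimir, smul_zero, add_zero, diff_lenardH]
    -- Since `B_l = 0`, there is no earlier site and the gradient at `l` commutes with `A_l`.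
    have hB : (partialSum A l).val = 0 := by
      rw [partialSum_val]
      refine Finset.sum_eq_zero fun j hj => ?_
      have := (Finset.mem_filter.1 hj).2
      exact absurd (Fin.lt_def.1 this) (by omega)
    funext i
    apply Subtype.ext
    rw [tensorP_trForm]
    change _ = (0 : Matrix (Fin r) (Fin r) ℂ)
    rcases lt_trichotomy i l with h | rfl | h
    · exact absurd (Fin.lt_def.1 h) (by omega)
    · have hc := pencil_comm (A i).val (partialSum A i).val β β
      rw [hB, zero_mul, mul_zero, add_zero, add_zero] at hc
      rw [gradH_self, Nat.add_sub_cancel, hB, Matrix.mul_smul, Matrix.smul_mul, hc, sub_self]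
    · rw [gradH_of_gt A h]; simp

theorem diff_sum {ι : Type*} (s : Finset ι) (c : ι → ℂ) (f : ι → Phase N r → ℂ)
    (hf : ∀ i, Differentiable ℂ (f i)) (A : Phase N r) :
    diff (fun A => ∑ i ∈ s, c i * f i A) A = ∑ i ∈ s, c i • diff (f i) A := by
  have h : HasFDerivAt (fun A => ∑ i ∈ s, c i * f i A) (∑ i ∈ s, c i • fderiv ℂ (f i) A) A :=
    HasFDerivAt.fun_sum fun i _ => (hf i A).hasFDerivAt.const_mul (c i)
  unfold diff
  rw [h.fderiv]
  ext V
  simp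

theorem lenardK_self (β : ℕ) (l : Fin N) :
    (lenardK β β l : Phase N r → ℂ) = lenardH β β l := by
  funext A; simp [lenardK]

theorem lenardK_of_lt {α β : ℕ} (h : α < β) (l : Fin N) :
    (lenardK α β l : Phase N r → ℂ) = fun A => ∑ j ∈ Finset.range (β - α),
      (((β - α - 1).choose j : ℂ) * ((l.val : ℂ) - 1) ^ (β - α - 1 - j))
        * lenardH (β - 1 - j) β l A := by
  funext A; rw [lenardK, if_neg (by omega)]

/-- Pascal's rule, in the form that turns the Lenard recursion into a chain. -/
theorem pascal_sum {M : Type*} [AddCommGroup M] [Module ℂ M] (c : ℂ) (u : ℕ → M) (p : ℕ) :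
    ∑ j ∈ Finset.range (p + 2), (((p + 1).choose j : ℂ) * c ^ (p + 1 - j)) • u j
      = ∑ j ∈ Finset.range (p + 1), ((p.choose j : ℂ) * c ^ (p - j)) • (u (j + 1) + c • u j) := by
  have h1 : ∑ j ∈ Finset.range (p + 1), ((p.choose j : ℂ) * c ^ (p - j)) • c • u j
      = ∑ j ∈ Finset.range (p + 1), ((p.choose (j + 1) : ℂ) * c ^ (p - j)) • u (j + 1)
        + c ^ (p + 1) • u 0 := by
    have h2 : ∑ j ∈ Finset.range (p + 1), ((p.choose j : ℂ) * c ^ (p - j)) • c • u j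
        = ∑ j ∈ Finset.range (p + 2), ((p.choose j : ℂ) * c ^ (p + 1 - j)) • u j := by
      rw [Finset.sum_range_succ _ (p + 1), Nat.choose_succ_self]
      simp only [Nat.cast_zero, zero_mul, zero_smul, add_zero]
      refine Finset.sum_congr rfl fun j hj => ?_
      have hj' := Finset.mem_range.1 hj
      rw [smul_smul, mul_assoc, ← pow_succ, show p - j + 1 = p + 1 - j by omega]
    rw [h2, Finset.sum_range_succ']
    simp
  simp only [smul_add, Finset.sum_add_distrib]
  rw [h1, Finset.sum_range_succ', ← add_assoc, ← Finset.sum_add_distrib]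
  congr 1
  · refine Finset.sum_congr rfl fun j _ => ?_
    rw [Nat.choose_succ_succ, Nat.cast_add, add_mul, add_smul, Nat.add_sub_add_right]
  · simp

theorem lenard_chain (l : Fin N) {α β : ℕ} (h1 : 1 ≤ α) (h2 : α ≤ β) (A : Phase N r) :
    tensorP A (diff (lenardK (α - 1) β l) A) = tensorR A (diff (lenardK α β l) A) := by
  rw [lenardK_of_lt (by omega : α - 1 < β), diff_sum _ _ _ fun _ => differentiable_lenardH _ _ _]
  simp only [map_sum, map_smul]
  rcases h2.eq_or_lt with rfl | h3
  · obtain ⟨n, rfl⟩ : ∃ n, α = n + 1 := ⟨α - 1, by omega⟩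
    rw [lenardK_self, tensorR_diff_lenardH_succ, tensorP_diff_casimir, Nat.add_sub_cancel,
      show n + 1 - n = 1 by omega]
    simp
  · obtain ⟨p, hp⟩ : ∃ p, β - α = p + 1 := ⟨β - α - 1, by omega⟩
    rw [lenardK_of_lt h3, diff_sum _ _ _ fun _ => differentiable_lenardH _ _ _]
    simp only [map_sum, map_smul]
    rw [show β - (α - 1) = p + 2 by omega, hp]
    refine (pascal_sum ((l.val : ℂ) - 1)
      (fun j => tensorP A (diff (lenardH (β - 1 - j) β l) A)) p).trans ?_
    refine Finset.sum_congr rfl fun j hj => ?_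
    have hj' := Finset.mem_range.1 hj
    rw [show β - 1 - j = β - 1 - (j + 1) + 1 by omega, tensorR_diff_lenardH_succ]
    rfl

theorem lenardK_eq_add {α β : ℕ} (h : α < β) (l : Fin N) :
    (lenardK α β l : Phase N r → ℂ) = lenardH α β l + ∑ j ∈ Finset.range (β - α - 1),
      (((β - α - 1).choose j : ℂ) * ((l.val : ℂ) - 1) ^ (β - α - 1 - j))
        • (lenardH (β - 1 - j) β l : Phase N r → ℂ) := by
  obtain ⟨p, hp⟩ : ∃ p, β - α = p + 1 := ⟨β - α - 1, by omega⟩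
  rw [lenardK_of_lt h, hp]
  funext A
  rw [Finset.sum_range_succ, show β - 1 - p = α by omega]
  simp [add_comm]

theorem span_lenardK (l : Fin N) (β : ℕ) :
    Submodule.span ℂ ((fun α => (lenardK α β l : Phase N r → ℂ)) '' Set.Icc 1 (β - 1))
      = Submodule.span ℂ ((fun α => (lenardH α β l : Phase N r → ℂ)) '' Set.Icc 1 (β - 1)) := by
  apply le_antisymm
  · rw [Submodule.span_le]
    rintro _ ⟨α, ⟨h1, h2⟩, rfl⟩
    have hm : ∀ α' ∈ Set.Icc 1 (β - 1), (lenardH α' β l : Phase N r → ℂ) ∈ Submodule.span ℂ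
        ((fun α => (lenardH α β l : Phase N r → ℂ)) '' Set.Icc 1 (β - 1)) := fun α' h =>
      Submodule.subset_span ⟨α', h, rfl⟩
    simp only [SetLike.mem_coe]
    rw [lenardK_eq_add (by omega)]
    refine add_mem (hm _ ⟨h1, h2⟩) (sum_mem fun j hj => Submodule.smul_mem _ _ (hm _ ?_))
    have := Finset.mem_range.1 hj
    constructor <;> omega
  · rw [Submodule.span_le]
    rintro _ ⟨α, ⟨h1, h2⟩, rfl⟩
    simp only [SetLike.mem_coe]
    -- The change of basis is unitriangular: descending induction on `α`.
    induction hk : β - α using Nat.strong_induction_on generalizing α with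
    | _ k ih =>
      have hK : (lenardK α β l : Phase N r → ℂ) ∈ Submodule.span ℂ
          ((fun α => (lenardK α β l : Phase N r → ℂ)) '' Set.Icc 1 (β - 1)) :=
        Submodule.subset_span ⟨α, ⟨h1, h2⟩, rfl⟩
      rw [lenardK_eq_add (by omega)] at hK
      refine (Submodule.add_mem_iff_left _ (sum_mem fun j hj => Submodule.smul_mem _ _ ?_)).1 hK
      have := Finset.mem_range.1 hj
      exact ih (β - (β - 1 - j)) (by omega) _ (by omega) (by omega) rfl

/-! ### Functions of the total -/

theorem total_val (A : Phase N r) : (total A).val = ∑ i, (A i).val := sum_coe _ _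

/-- `A ↦ A_tot` as a linear map to matrices. -/
noncomputable def totalLin : Phase N r →ₗ[ℂ] Matrix (Fin r) (Fin r) ℂ := ∑ i, siteLin i

theorem totalLin_apply (A : Phase N r) : totalLin A = (total A).val := by
  rw [total_val, totalLin, LinearMap.sum_apply]; rfl

theorem sum_trace_mul_const (Y : Matrix (Fin r) (Fin r) ℂ) (V : Phase N r) :
    ∑ j, (Y * (V j).val).trace = (Y * (total V).val).trace := by
  rw [total_val, Finset.mul_sum, Matrix.trace_sum]

theorem hasGrad_linearH (τ : Matrix (Fin r) (Fin r) ℂ) (A : Phase N r) :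
    HasGrad (linearH τ) (fun _ => τ) A := by
  have h : (linearH τ : Phase N r → ℂ) = LinearMap.toContinuousLinearMap
      (Matrix.traceLinearMap (Fin r) ℂ ℂ ∘ₗ LinearMap.mulLeft ℂ τ ∘ₗ totalLin) := by
    funext A
    simp [linearH, totalLin_apply, Matrix.trace_mul_comm τ]
  rw [h]
  refine HasGrad.of_eq (L := Matrix.traceLinearMap (Fin r) ℂ ℂ ∘ₗ LinearMap.mulLeft ℂ τ ∘ₗ totalLin)
    (ContinuousLinearMap.hasFDerivAt _) fun V => ?_
  rw [sum_trace_mul_const, ← totalLin_apply]; rfl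

/-- The matrix of the inclusion `ℂ ^ m ⊆ ℂ ^ r` onto the first `m` coordinates. -/
def cornerIncl {m : ℕ} (hm : m ≤ r) : Matrix (Fin r) (Fin m) ℂ :=
  Matrix.of fun i j => if i = Fin.castLE hm j then 1 else 0

theorem mul_cornerIncl {ι : Type*} {m : ℕ} (hm : m ≤ r) (X : Matrix ι (Fin r) ℂ) :
    X * cornerIncl hm = X.submatrix id (Fin.castLE hm) := by
  ext i j
  simp [Matrix.mul_apply, cornerIncl]

theorem cornerIncl_transpose_mul {ι : Type*} {m : ℕ} (hm : m ≤ r) (X : Matrix (Fin r) ι ℂ) :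
    (cornerIncl hm).transpose * X = X.submatrix (Fin.castLE hm) id := by
  ext i j
  simp [Matrix.mul_apply, cornerIncl]

theorem submatrix_castLE {m : ℕ} (hm : m ≤ r) (X : Matrix (Fin r) (Fin r) ℂ) :
    X.submatrix (Fin.castLE hm) (Fin.castLE hm)
      = (cornerIncl hm).transpose * (X * cornerIncl hm) := by
  rw [mul_cornerIncl, cornerIncl_transpose_mul, Matrix.submatrix_submatrix]; rfl

theorem cornerIncl_comp {k m : ℕ} (hkm : k ≤ m) (hm : m ≤ r) :
    cornerIncl (hkm.trans hm) = cornerIncl hm * cornerIncl hkm := by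
  rw [mul_cornerIncl]
  ext i j
  simp [cornerIncl]

theorem cornerIncl_transpose_mul_self {m : ℕ} (hm : m ≤ r) :
    (cornerIncl hm).transpose * cornerIncl hm = 1 := by
  rw [cornerIncl_transpose_mul]
  ext i j
  simp [cornerIncl, Matrix.one_apply]

/-- The trace-free part of the upper left `m × m` block. -/
noncomputable def corner {m : ℕ} (hm : m ≤ r) (X : Matrix (Fin r) (Fin r) ℂ) :
    Matrix (Fin m) (Fin m) ℂ :=
  tracelessPart (X.submatrix (Fin.castLE hm) (Fin.castLE hm))

/-- `corner` as a linear map. -/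
noncomputable def cornerLin {m : ℕ} (hm : m ≤ r) :
    Matrix (Fin r) (Fin r) ℂ →ₗ[ℂ] Matrix (Fin m) (Fin m) ℂ :=
  slIncl m ∘ₗ toSlLin m ∘ₗ
    { toFun := fun X => X.submatrix (Fin.castLE hm) (Fin.castLE hm)
      map_add' := fun _ _ => rfl
      map_smul' := fun _ _ => rfl }

theorem cornerLin_apply {m : ℕ} (hm : m ≤ r) (X : Matrix (Fin r) (Fin r) ℂ) :
    cornerLin hm X = corner hm X := rfl

/-- The gradient of the Gel'fand–Cetlin function `tr (π_m X) ^ β` on matrices. -/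
noncomputable def cornerGrad {m : ℕ} (hm : m ≤ r) (β : ℕ) (X : Matrix (Fin r) (Fin r) ℂ) :
    Matrix (Fin r) (Fin r) ℂ :=
  (β : ℂ) • (cornerIncl hm * tracelessPart (corner hm X ^ (β - 1)) * (cornerIncl hm).transpose)

theorem hasGrad_gelfandCetlin (m β : ℕ) (hm : m ≤ r) (A : Phase N r) :
    HasGrad (gelfandCetlin m β hm) (fun _ => cornerGrad hm β (total A).val) A := by
  have h := hasFDerivAt_trace_pow (cornerLin hm ∘ₗ totalLin) β A
  have hf : (gelfandCetlin m β hm : Phase N r → ℂ)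
      = fun A => (((cornerLin hm ∘ₗ totalLin) A) ^ β).trace := by
    funext A; rw [LinearMap.comp_apply, totalLin_apply]; rfl
  rw [hf]
  refine HasGrad.of_eq h fun V => ?_
  rw [sum_trace_mul_const, cornerGrad]
  simp only [LinearMap.smul_apply, LinearMap.comp_apply, Matrix.traceLinearMap_apply,
    LinearMap.mulLeft_apply, totalLin_apply, smul_eq_mul, Matrix.smul_mul, Matrix.trace_smul,
    cornerLin_apply]
  congr 1
  rw [corner.eq_1 hm (total V).val, trace_mul_tracelessPart, submatrix_castLE,
    Matrix.mul_assoc, Matrix.mul_assoc,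
    Matrix.trace_mul_comm (cornerIncl hm), Matrix.mul_assoc, Matrix.mul_assoc]

/-- The gradient with respect to `A_tot` of a function of `extraFamily`. -/
noncomputable def extraGrad (r : ℕ) :
    CartanIdx r ⊕ GCIdx r → Matrix (Fin r) (Fin r) ℂ → Matrix (Fin r) (Fin r) ℂ :=
  Sum.elim (fun k _ => cartanMatrix k)
    (fun s => cornerGrad (Nat.add_lt_of_lt_sub s.1.isLt).le (s.2.val + 2))

theorem hasGrad_extraFamily (s : CartanIdx r ⊕ GCIdx r) (A : Phase N r) :
    HasGrad (extraFamily N r s) (fun _ => extraGrad r s (total A).val) A := by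
  rcases s with k | s
  · exact hasGrad_linearH _ A
  · exact hasGrad_gelfandCetlin _ _ _ A

theorem diff_extraFamily (s : CartanIdx r ⊕ GCIdx r) (A : Phase N r) :
    diff (extraFamily N r s) A = trForm fun _ => extraGrad r s (total A).val :=
  (hasGrad_extraFamily s A).diff

/-- On functions of `A_tot` the two tensors are proportional. -/
theorem tensorR_const (A : Phase N r) (Y : Matrix (Fin r) (Fin r) ℂ) :
    tensorR A (trForm fun _ => Y) = ((N : ℂ) - 1) • tensorP A (trForm fun _ => Y) := by
  funext i
  apply Subtype.ext
  change _ = ((N : ℂ) - 1) • (tensorP A (trForm fun _ => Y) i).val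
  have hc : (Finset.univ.filter (i < ·)).card = N - 1 - i.val := by
    rw [show (Finset.univ.filter (i < ·)) = Finset.Ioi i by ext; simp, Fin.card_Ioi]
  rw [tensorR_trForm', tensorP_trForm, sum_sub_comm, ← partialSum_val, Finset.sum_const, hc,
    ← Nat.cast_smul_eq_nsmul ℂ, Nat.sub_sub, Nat.cast_sub (by omega)]
  push_cast
  simp only [sub_mul, mul_sub, Matrix.smul_mul, Matrix.mul_smul]
  module

theorem pairing_const_const (A : Phase N r) (Y Z : Matrix (Fin r) (Fin r) ℂ) :
    trForm (fun _ => Y) (tensorP A (trForm fun _ => Z))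
      = (Y * ((total A).val * Z - Z * (total A).val)).trace := by
  rw [trForm_tensorP_trForm, ← Matrix.trace_sum, ← Finset.mul_sum, sum_sub_comm, total_val]

theorem commute_corner {m : ℕ} (hm : m ≤ r) (β : ℕ) (X : Matrix (Fin r) (Fin r) ℂ) :
    (cornerIncl hm).transpose * (X * cornerIncl hm) * tracelessPart (corner hm X ^ β)
      = tracelessPart (corner hm X ^ β) * ((cornerIncl hm).transpose * (X * cornerIncl hm)) := by
  rw [← submatrix_castLE]
  have h : Commute (X.submatrix (Fin.castLE hm) (Fin.castLE hm)) (corner hm X) := by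
    unfold corner tracelessPart
    exact (Commute.refl _).sub_right ((Commute.one_right _).smul_right _)
  exact (h.pow_right β).sub_right ((Commute.one_right _).smul_right _)

/-- Gel'fand–Cetlin functions of nested blocks commute: the trace only sees the larger block, on
which the gradient of the outer function commutes with the block itself. -/
theorem cornerGrad_involutive {k m : ℕ} (hkm : k ≤ m) (hm : m ≤ r) (α β : ℕ)
    (X : Matrix (Fin r) (Fin r) ℂ) :
    (cornerGrad (hkm.trans hm) α X
      * (X * cornerGrad hm β X - cornerGrad hm β X * X)).trace = 0 := by
  have hc := commute_corner hm (β - 1) X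
  unfold cornerGrad
  generalize tracelessPart (corner hm X ^ (β - 1)) = W at *
  generalize tracelessPart (corner (hkm.trans hm) X ^ (α - 1)) = V
  rw [cornerIncl_comp hkm hm]
  set J := cornerIncl hm
  set K := cornerIncl hkm
  have hJ : J.transpose * J = 1 := cornerIncl_transpose_mul_self hm
  simp only [Matrix.smul_mul, Matrix.mul_smul, ← smul_sub, Matrix.trace_smul, smul_eq_mul]
  rw [show (J * K * V * (J * K).transpose * (X * (J * W * J.transpose)
      - J * W * J.transpose * X)).trace = 0 from ?_]
  · simp
  have e : (J * K * V * (J * K).transpose * (X * (J * W * J.transpose)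
      - J * W * J.transpose * X)).trace
      = (K * V * K.transpose * (J.transpose * (X * J) * W - W * (J.transpose * (X * J)))).trace := by
    rw [Matrix.transpose_mul, mul_sub, mul_sub, Matrix.trace_sub, Matrix.trace_sub]
    congr 1
    · calc (J * K * V * (K.transpose * J.transpose) * (X * (J * W * J.transpose))).trace
          = (J * (K * V * K.transpose * (J.transpose * (X * J) * W) * J.transpose)).trace := by
            simp only [Matrix.mul_assoc]
        _ = _ := by
            rw [Matrix.trace_mul_comm, Matrix.mul_assoc, hJ, Matrix.mul_one]
    · calc (J * K * V * (K.transpose * J.transpose) * (J * W * J.transpose * X)).trace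
          = (J * (K * V * K.transpose * ((J.transpose * J) * (W * (J.transpose * X))))).trace := by
            simp only [Matrix.mul_assoc]
        _ = _ := by
            rw [Matrix.trace_mul_comm, hJ, Matrix.one_mul]
            simp only [Matrix.mul_assoc]
  rw [e, hc, sub_self, mul_zero, Matrix.trace_zero]

theorem cartan_cornerGrad_involutive (k : Fin (r - 1)) {m : ℕ} (hm : m ≤ r) (β : ℕ)
    (X : Matrix (Fin r) (Fin r) ℂ) :
    (cartanMatrix k * (X * cornerGrad hm β X - cornerGrad hm β X * X)).trace = 0 := by
  have hc := commute_corner hm (β - 1) X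
  unfold cornerGrad
  generalize tracelessPart (corner hm X ^ (β - 1)) = W at *
  set J := cornerIncl hm with hJ
  obtain ⟨h, h1, h2⟩ : ∃ h : Matrix (Fin m) (Fin m) ℂ, cartanMatrix k * J = J * h
      ∧ J.transpose * cartanMatrix k = h * J.transpose := by
    refine ⟨Matrix.diagonal fun a =>
      (if a.val = k.val then (1 : ℂ) else 0) - (if a.val = k.val + 1 then (1 : ℂ) else 0), ?_, ?_⟩
    · ext i j
      rw [cartanMatrix, Matrix.diagonal_mul, Matrix.mul_diagonal, hJ, cornerIncl, Matrix.of_apply]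
      split_ifs <;> simp_all
    · ext i j
      rw [cartanMatrix, Matrix.diagonal_mul, Matrix.mul_diagonal, Matrix.transpose_apply, hJ,
        cornerIncl, Matrix.of_apply]
      split_ifs <;> simp_all
  simp only [Matrix.smul_mul, Matrix.mul_smul, ← smul_sub, Matrix.trace_smul, smul_eq_mul]
  rw [show (cartanMatrix k * (X * (J * W * J.transpose) - J * W * J.transpose * X)).trace = 0
    from ?_, mul_zero]
  have e1 : (cartanMatrix k * (X * (J * W * J.transpose))).trace
      = (h * (J.transpose * (X * J) * W)).trace := by
    rw [show cartanMatrix k * (X * (J * W * J.transpose))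
      = (cartanMatrix k * (X * (J * W))) * J.transpose by simp only [Matrix.mul_assoc],
      Matrix.trace_mul_comm, ← Matrix.mul_assoc, h2]
    simp only [Matrix.mul_assoc]
  have e2 : (cartanMatrix k * (J * W * J.transpose * X)).trace
      = (h * (W * (J.transpose * (X * J)))).trace := by
    rw [show cartanMatrix k * (J * W * J.transpose * X)
      = (cartanMatrix k * J) * (W * (J.transpose * X)) by simp only [Matrix.mul_assoc], h1,
      Matrix.mul_assoc,
      Matrix.trace_mul_comm]
    simp only [Matrix.mul_assoc]
  rw [mul_sub, Matrix.trace_sub, e1, e2, hc, sub_self]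

theorem trace_mul_lie_antisymm (X Y Z : Matrix (Fin r) (Fin r) ℂ) :
    (Y * (X * Z - Z * X)).trace = -(Z * (X * Y - Y * X)).trace := by
  rw [mul_sub, mul_sub, Matrix.trace_sub, Matrix.trace_sub,
    show (Y * (X * Z)).trace = (Z * (Y * X)).trace from Matrix.trace_mul_cycle' _ _ _,
    show (Z * (X * Y)).trace = (Y * (Z * X)).trace from Matrix.trace_mul_cycle' _ _ _]
  ring

theorem extraGrad_involutive (s t : CartanIdx r ⊕ GCIdx r) (X : Matrix (Fin r) (Fin r) ℂ) :
    (extraGrad r s X * (X * extraGrad r t X - extraGrad r t X * X)).trace = 0 := by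
  rcases s with k | s <;> rcases t with j | t
  · have h : cartanMatrix k * cartanMatrix j = cartanMatrix j * cartanMatrix k := by
      unfold cartanMatrix
      rw [Matrix.diagonal_mul_diagonal, Matrix.diagonal_mul_diagonal]
      simp only [mul_comm]
    change (cartanMatrix k * (X * cartanMatrix j - cartanMatrix j * X)).trace = 0
    rw [mul_sub, Matrix.trace_sub, ← mul_assoc, ← mul_assoc,
      Matrix.trace_mul_comm (cartanMatrix k * X), ← mul_assoc, h, sub_self]
  · exact cartan_cornerGrad_involutive _ _ _ _
  · rw [trace_mul_lie_antisymm]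
    exact neg_eq_zero.2 (cartan_cornerGrad_involutive _ _ _ _)
  · rcases le_total s.1.val t.1.val with h | h
    · exact cornerGrad_involutive (by omega) (Nat.add_lt_of_lt_sub t.1.isLt).le _ _ _
    · rw [trace_mul_lie_antisymm]
      exact neg_eq_zero.2
        (cornerGrad_involutive (by omega) (Nat.add_lt_of_lt_sub s.1.isLt).le _ _ _)

/-! ### Involutivity -/

theorem fullFamily_cases (s : CasimirIdx N r ⊕ (ChainIdx N r ⊕ (CartanIdx r ⊕ GCIdx r))) :
    (∃ α β l, fullFamily N r s = lenardH α β l) ∨ ∃ t, fullFamily N r s = extraFamily N r t := by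
  rcases s with s | s | s
  · exact Or.inl ⟨_, _, _, casimir_eq _ _⟩
  · exact Or.inl ⟨_, _, _, rfl⟩
  · exact Or.inr ⟨_, rfl⟩

theorem fullFamily_pairing (s t : CasimirIdx N r ⊕ (ChainIdx N r ⊕ (CartanIdx r ⊕ GCIdx r)))
    (A : Phase N r) :
    diff (fullFamily N r s) A (tensorP A (diff (fullFamily N r t) A)) = 0 := by
  rcases fullFamily_cases s with ⟨α, β, l, hs⟩ | ⟨x, hs⟩ <;>
  rcases fullFamily_cases t with ⟨α', β', l', ht⟩ | ⟨y, ht⟩ <;> rw [hs, ht]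
  · rw [diff_lenardH, diff_lenardH, pairing_gradH_gradH]
  · rw [diff_lenardH, diff_extraFamily, pairing_gradH_const _ _ _ _ _ _ fun _ _ => rfl]
  · rw [diff_lenardH, diff_extraFamily, pairing_antisymm,
      pairing_gradH_const _ _ _ _ _ _ fun _ _ => rfl, neg_zero]
  · rw [diff_extraFamily, diff_extraFamily, pairing_const_const, extraGrad_involutive]

theorem pairing_lenardH (s : CasimirIdx N r ⊕ (ChainIdx N r ⊕ (CartanIdx r ⊕ GCIdx r)))
    (α β : ℕ) (l : Fin N) (A : Phase N r) :
    diff (fullFamily N r s) A (tensorP A (diff (lenardH α β l) A)) = 0 := by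
  rcases fullFamily_cases s with ⟨α', β', l', hs⟩ | ⟨x, hs⟩ <;> rw [hs]
  · rw [diff_lenardH, diff_lenardH, pairing_gradH_gradH]
  · rw [diff_lenardH, diff_extraFamily, pairing_antisymm,
      pairing_gradH_const _ _ _ _ _ _ fun _ _ => rfl, neg_zero]

theorem bracketP_fullFamily (s t : CasimirIdx N r ⊕ (ChainIdx N r ⊕ (CartanIdx r ⊕ GCIdx r)))
    (A : Phase N r) : bracketP (fullFamily N r s) (fullFamily N r t) A = 0 :=
  fullFamily_pairing s t A

/-- Involutivity for `R` reduces to that for `P`: by the Lenard recursion, and because `R` and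
`(N - 1) P` agree on functions of `A_tot`. -/
theorem bracketR_fullFamily (s t : CasimirIdx N r ⊕ (ChainIdx N r ⊕ (CartanIdx r ⊕ GCIdx r)))
    (A : Phase N r) : bracketR (fullFamily N r s) (fullFamily N r t) A = 0 := by
  unfold bracketR
  rcases fullFamily_cases t with ⟨α, β, l, ht⟩ | ⟨y, ht⟩
  · rw [ht]
    rcases α with _ | α
    · rw [tensorR_diff_lenardH_zero, map_smul, pairing_lenardH, smul_zero]
    · rw [tensorR_diff_lenardH_succ, map_add, map_smul, pairing_lenardH, pairing_lenardH,
        smul_zero, add_zero]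
  · have h := fullFamily_pairing s t A
    rw [ht, diff_extraFamily] at h
    rw [ht, diff_extraFamily, tensorR_const, map_smul, h, smul_zero]

theorem differentiable_fullFamily
    (s : CasimirIdx N r ⊕ (ChainIdx N r ⊕ (CartanIdx r ⊕ GCIdx r))) :
    Differentiable ℂ (fullFamily N r s) := by
  rcases fullFamily_cases s with ⟨α, β, l, hs⟩ | ⟨x, hs⟩ <;> rw [hs]
  · exact differentiable_lenardH _ _ _
  · exact fun A => HasFDerivAt.differentiableAt (hasGrad_extraFamily x A)

/-! ### The Gaudin Hamiltonian -/

theorem lenardH_one_two (l : Fin N) (A : Phase N r) :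
    lenardH 1 2 l A = 2 * ∑ j ∈ Finset.univ.filter (· < l), ((A l).val * (A j).val).trace := by
  rw [lenardH_eq, pencil_succ, pencilShift_succ, pencil_coeff_zero, pencil_self, Matrix.trace_add,
    pow_one, pow_one, Matrix.trace_mul_comm (partialSum A l).val, ← two_mul, partialSum_val,
    Finset.mul_sum, Matrix.trace_sum]

theorem gaudinH_eq : (gaudinH : Phase N r → ℂ)
    = fun A => ∑ l ∈ Finset.univ.filter (fun l : Fin N => 0 < l.val), lenardH 1 2 l A := by
  funext A
  have h0 : ∑ l ∈ Finset.univ.filter (fun l : Fin N => 0 < l.val), lenardH 1 2 l A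
      = ∑ l, lenardH 1 2 l A := by
    refine Finset.sum_filter_of_ne fun l _ hl => ?_
    by_contra h
    refine hl ?_
    rw [lenardH_one_two, Finset.sum_eq_zero, mul_zero]
    intro j hj
    exact absurd (Fin.lt_def.1 (Finset.mem_filter.1 hj).2) (by omega)
  have hsplit : ∀ i : Fin N, ∑ j ∈ Finset.univ.filter (· ≠ i), ((A i).val * (A j).val).trace
      = ∑ j ∈ Finset.univ.filter (· < i), ((A i).val * (A j).val).trace
        + ∑ j ∈ Finset.univ.filter (i < ·), ((A i).val * (A j).val).trace := fun i => by
    rw [← Finset.sum_union]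
    · congr 1
      ext j; simp
    · rw [Finset.disjoint_filter]
      intro j _ h1 h2
      exact lt_asymm h1 h2
  have hswap : ∑ i : Fin N, ∑ j ∈ Finset.univ.filter (i < ·), ((A i).val * (A j).val).trace
      = ∑ i : Fin N, ∑ j ∈ Finset.univ.filter (· < i), ((A i).val * (A j).val).trace := by
    simp only [Finset.sum_filter]
    rw [Finset.sum_comm]
    refine Finset.sum_congr rfl fun i _ => Finset.sum_congr rfl fun j _ => ?_
    rw [Matrix.trace_mul_comm]
  rw [h0]
  simp only [lenardH_one_two, ← Finset.mul_sum]
  unfold gaudinH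
  rw [Finset.sum_congr rfl fun i _ => hsplit i, Finset.sum_add_distrib, hswap, two_mul]

/-! ### The numbers of functions -/

theorem sum_fin_succ (n : ℕ) : ∑ b : Fin n, (b.val + 1) = (n + 1) * n / 2 := by
  have h := Finset.sum_range_id (n + 1)
  rw [Finset.sum_range_succ', add_zero, Nat.add_sub_cancel] at h
  rw [Fin.sum_univ_eq_sum_range (fun b => b + 1) n, h]

theorem card_chainIdx (hr : 2 ≤ r) :
    Fintype.card (ChainIdx N r) = (N - 1) * (r * (r - 1) / 2) := by
  rw [Fintype.card_prod, Fintype.card_sigma]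
  simp only [Fintype.card_fin]
  rw [sum_fin_succ, show r - 1 + 1 = r by omega]

theorem card_casimirIdx : Fintype.card (CasimirIdx N r) = N * (r - 1) := by
  rw [Fintype.card_prod, Fintype.card_fin, Fintype.card_fin]

theorem card_extraIdx (hr : 2 ≤ r) :
    Fintype.card (CartanIdx r ⊕ GCIdx r) = r * (r - 1) / 2 := by
  rw [Fintype.card_sum, Fintype.card_sigma]
  simp only [Fintype.card_fin]
  obtain ⟨n, rfl⟩ : ∃ n, r = n + 2 := ⟨r - 2, by omega⟩
  have := sum_fin_succ (n + 1)
  rw [Fin.sum_univ_castSucc] at this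
  simp only [Fin.val_castSucc, Fin.val_last] at this
  rw [show n + 2 - 1 = n + 1 by omega, show n + 2 - 2 = n by omega, ← this, add_comm]

/-! ### Genericity -/

section Genericity

variable {E : Type*} [NormedAddCommGroup E] [NormedSpace ℂ E]

theorem differentiable_finsetProd {ι : Type*} (s : Finset ι) {f : ι → E → ℂ}
    (hf : ∀ i, Differentiable ℂ (f i)) : Differentiable ℂ fun x => ∏ i ∈ s, f i x := by
  classical
  exact fun x => (HasFDerivAt.finsetProd fun i _ => (hf i x).hasFDerivAt).differentiableAt

/-- The points at which a holomorphic family of vectors is linearly independent contain the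
complement of the zero set of a minor. -/
theorem exists_minor {W ι : Type*} [NormedAddCommGroup W] [NormedSpace ℂ W]
    [FiniteDimensional ℂ W] [Fintype ι] (v : ι → E → W) (hv : ∀ i, Differentiable ℂ (v i))
    (x₀ : E) (h₀ : LinearIndependent ℂ fun i => v i x₀) :
    ∃ D : E → ℂ, Differentiable ℂ D ∧ D x₀ ≠ 0 ∧
      ∀ x, D x ≠ 0 → LinearIndependent ℂ fun i => v i x := by
  classical
  obtain ⟨g, hg⟩ := LinearMap.exists_leftInverse_of_injective
    (Fintype.linearCombination ℂ fun i => v i x₀)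
    (LinearMap.ker_eq_bot.2 (linearIndependent_iff_injective_fintypeLinearCombination.1 h₀))
  refine ⟨fun x => Matrix.det (Matrix.of fun i j => g (v i x) j), ?_, ?_, fun x hx => ?_⟩
  · simp only [Matrix.det_apply]
    refine Differentiable.fun_sum fun σ _ => Differentiable.const_smul ?_ _
    refine differentiable_finsetProd _ fun i => ?_
    exact (differentiable_linearMap (LinearMap.proj i ∘ₗ g)).comp (hv _)
  · have : (Matrix.of fun i j => g (v i x₀) j) = (1 : Matrix ι ι ℂ) := by
      ext i j
      have h := congrArg (fun f => f (Pi.single i 1) j) hg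
      simpa [Fintype.linearCombination_apply_single, Matrix.one_apply, Pi.single_apply,
        eq_comm] using h
    simp [this]
  · have h := Matrix.linearIndependent_rows_of_det_ne_zero hx
    exact LinearIndependent.of_comp g h

/-- A holomorphic function that is not identically zero does not vanish on any open set. -/
theorem dense_ne_zero {D : E → ℂ} (hD : Differentiable ℂ D) {x₀ : E} (h₀ : D x₀ ≠ 0) :
    Dense {x | D x ≠ 0} := by
  intro x
  by_contra hx
  have h1 : ∀ᶠ y in 𝓝 x, D y = 0 := by
    filter_upwards [isClosed_closure.isOpen_compl.mem_nhds hx] with y hy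
    by_contra hy'
    exact hy (subset_closure hy')
  -- Restrict `D` to the complex line through `x` and `x₀`.
  have hl : Differentiable ℂ fun t : ℂ => x + t • (x₀ - x) := by fun_prop
  have hg : Differentiable ℂ fun t : ℂ => D (x + t • (x₀ - x)) := hD.comp hl
  have h2 : (fun t : ℂ => D (x + t • (x₀ - x))) =ᶠ[𝓝 0] fun _ => 0 := by
    have hc : Filter.Tendsto (fun t : ℂ => x + t • (x₀ - x)) (𝓝 0) (𝓝 x) := by
      simpa using hl.continuous.tendsto 0
    exact hc.eventually h1
  have h3 := AnalyticOnNhd.eq_of_eventuallyEq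
    (hg.differentiableOn.analyticOnNhd isOpen_univ) analyticOnNhd_const h2
  exact h₀ (by simpa using congrFun h3 1)

theorem exists_forall_ne_zero {ι : Type*} [Fintype ι] (D : ι → E → ℂ)
    (hD : ∀ i, Differentiable ℂ (D i)) (h : ∀ i, ∃ x, D i x ≠ 0) : ∃ x, ∏ i, D i x ≠ 0 := by
  classical
  have key : ∀ s : Finset ι, ∃ x, ∏ i ∈ s, D i x ≠ 0 := by
    intro s
    induction s using Finset.induction_on with
    | empty => exact ⟨0, by simp⟩
    | insert i s hi ih =>
      obtain ⟨y, hy⟩ := h i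
      have ho : IsOpen {x | ∏ i ∈ s, D i x ≠ 0} :=
        isOpen_ne.preimage (continuous_finsetProd s fun i _ => (hD i).continuous)
      obtain ⟨x, hx, hx'⟩ := (dense_ne_zero (hD i) hy).inter_open_nonempty _ ho ih
      exact ⟨x, by rw [Finset.prod_insert hi]; exact mul_ne_zero hx' hx⟩
  exact key Finset.univ

end Genericity

/-! ### Density in the symplectic leaves -/



/-- The pencil `(1 - t) g + t`, as a matrix of polynomials in `t`. -/
noncomputable def segmentMatrix (g : Matrix (Fin r) (Fin r) ℂ) :
    Matrix (Fin r) (Fin r) (Polynomial ℂ) :=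
  g.map Polynomial.C + (Polynomial.X : Polynomial ℂ) • (1 - g).map Polynomial.C

theorem segmentMatrix_eval (g : Matrix (Fin r) (Fin r) ℂ) (t : ℂ) :
    (segmentMatrix g).map (Polynomial.eval t) = g + t • (1 - g) := by
  ext i j
  simp [segmentMatrix]

/-- `det G • (G a G⁻¹)` for `G = (1 - t) g + t`, as a matrix of polynomials in `t`. -/
noncomputable def segmentConj (g a : Matrix (Fin r) (Fin r) ℂ) :
    Matrix (Fin r) (Fin r) (Polynomial ℂ) :=
  segmentMatrix g * a.map Polynomial.C * (segmentMatrix g).adjugate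

theorem segmentConj_eval (g a : Matrix (Fin r) (Fin r) ℂ) (t : ℂ) :
    (segmentConj g a).map (Polynomial.eval t)
      = (g + t • (1 - g)) * a * (g + t • (1 - g)).adjugate := by
  have h : ∀ M : Matrix (Fin r) (Fin r) (Polynomial ℂ),
      M.map (Polynomial.eval t) = (Polynomial.evalRingHom t).mapMatrix M := fun _ => rfl
  have ha : (Polynomial.evalRingHom t).mapMatrix (a.map Polynomial.C) = a := by
    ext i j; simp
  rw [h, segmentConj, map_mul, map_mul, RingHom.map_adjugate, ha, ← h, segmentMatrix_eval]

theorem segmentMatrix_det_eval (g : Matrix (Fin r) (Fin r) ℂ) (t : ℂ) :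
    (segmentMatrix g).det.eval t = (g + t • (1 - g)).det := by
  have h : (segmentMatrix g).map (Polynomial.eval t)
    = (Polynomial.evalRingHom t).mapMatrix (segmentMatrix g) := rfl
  rw [← segmentMatrix_eval, h, ← RingHom.map_det]; rfl

theorem exists_GL {G : Matrix (Fin r) (Fin r) ℂ} (h : G.det ≠ 0) :
    ∃ g : GL (Fin r) ℂ, (g : Matrix (Fin r) (Fin r) ℂ) = G
      ∧ ((g⁻¹ : GL (Fin r) ℂ) : Matrix (Fin r) (Fin r) ℂ) = G.det⁻¹ • G.adjugate := by
  refine ⟨Matrix.GeneralLinearGroup.mkOfDetNeZero G h, rfl, ?_⟩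
  rw [Matrix.coe_units_inv, Matrix.inv_def, Ring.inverse_eq_inv']
  rfl

theorem toSl_eq_sum (M : Matrix (Fin r) (Fin r) ℂ) :
    toSl M = ∑ i, ∑ j, M i j • toSl (Matrix.single i j (1 : ℂ)) := by
  change toSlLin r M = ∑ i, ∑ j, M i j • toSlLin r (Matrix.single i j (1 : ℂ))
  conv_lhs => rw [Matrix.matrix_eq_sum_single M]
  simp only [map_sum, ← map_smul, Matrix.smul_single, smul_eq_mul, mul_one]

/-- A holomorphic function that is nonzero at a point of a leaf is nonzero on a dense subset of
that leaf: two points of the leaf are joined by a curve that depends holomorphically on a parameter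
in the complement of a finite set, which is connected. -/
theorem leaf_subset_closure {D : Phase N r → ℂ} (hD : Differentiable ℂ D) {A : Phase N r}
    (hA : D A ≠ 0) : leaf A ⊆ closure (leaf A ∩ {x | D x ≠ 0}) := by
  intro B hB
  choose g hg using hB
  let p : Fin N → Polynomial ℂ := fun i => (segmentMatrix (g i).val).det
  let q : Polynomial ℂ := ∏ i, p i
  let S : Set ℂ := {t | q.eval t ≠ 0}
  -- The curve in the leaf from `B` to `A` given by the segments from the `g i` to `1`.
  let γ : ℂ → Phase N r := fun t i => toSl (((p i).eval t)⁻¹ •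
    (segmentConj (g i).val (A i).val).map (Polynomial.eval t))
  have hp : ∀ t ∈ S, ∀ i, (p i).eval t ≠ 0 := fun t ht i => by
    have : (∏ i, (p i).eval t) ≠ 0 := by rw [← Polynomial.eval_prod]; exact ht
    exact Finset.prod_ne_zero_iff.1 this i (Finset.mem_univ i)
  have hS : ∀ t, (∀ i, (p i).eval t ≠ 0) → t ∈ S := fun t h => by
    change q.eval t ≠ 0
    rw [Polynomial.eval_prod]
    exact Finset.prod_ne_zero_iff.2 fun i _ => h i
  have hconj : ∀ t ∈ S, ∀ i, ∃ G : GL (Fin r) ℂ,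
      (G : Matrix (Fin r) (Fin r) ℂ) = (g i).val + t • (1 - (g i).val) ∧
      (γ t i).val = G.val * (A i).val * (G⁻¹).val := fun t ht i => by
    have h := hp t ht i
    simp only [p, segmentMatrix_det_eval] at h
    obtain ⟨G, hG, hG'⟩ := exists_GL h
    refine ⟨G, hG, ?_⟩
    simp only [γ, p]
    rw [toSl_val, segmentConj_eval, segmentMatrix_det_eval, ← Matrix.mul_smul, ← hG', ← hG]
    refine tracelessPart_of_trace_eq_zero ?_
    rw [Matrix.trace_mul_comm, ← mul_assoc, ← Units.val_mul, inv_mul_cancel, Units.val_one,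
      one_mul, sl_trace]
  have h0 : (0 : ℂ) ∈ S := hS 0 fun i => by
    simp only [p, segmentMatrix_det_eval, zero_smul, add_zero]
    exact (Matrix.isUnits_det_units (g i)).ne_zero
  have h1 : (1 : ℂ) ∈ S := hS 1 fun i => by
    simp [p, segmentMatrix_det_eval]
  have hγ0 : γ 0 = B := by
    funext i
    obtain ⟨G, hG, h⟩ := hconj 0 h0 i
    have : G = g i := Units.ext (by rw [hG]; simp)
    exact Subtype.ext (by rw [h, hg i, this])
  have hγ1 : γ 1 = A := by
    funext i
    obtain ⟨G, hG, h⟩ := hconj 1 h1 i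
    have : G = 1 := Units.ext (by rw [hG]; simp)
    exact Subtype.ext (by rw [h, this]; simp)
  have hq : q ≠ 0 := fun h => h0 (by rw [h]; simp)
  have hSc : Sᶜ.Finite := by
    refine (Polynomial.finite_setOfPred_isRoot hq).subset fun t ht => ?_
    simpa [S] using ht
  have hSo : IsOpen S := isClosed_compl_iff.1 hSc.isClosed
  have hSconn : IsPreconnected S := by
    have := (hSc.countable.isConnected_compl_of_one_lt_rank (by simp)).isPreconnected
    rwa [compl_compl] at this
  have hγ : DifferentiableOn ℂ γ S := by
    refine differentiableOn_pi.2 fun i => ?_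
    simp only [γ]
    simp only [toSl_eq_sum (_ • _)]
    refine DifferentiableOn.fun_sum fun a _ => DifferentiableOn.fun_sum fun b _ => ?_
    refine DifferentiableOn.smul_const ?_ _
    simp only [Matrix.smul_apply, Matrix.map_apply, smul_eq_mul]
    exact ((p i).differentiable.differentiableOn.inv fun t ht => hp t ht i).mul
      (Polynomial.differentiable _).differentiableOn
  by_contra hx
  have hnear : ∀ᶠ t in 𝓝 (0 : ℂ), D (γ t) = 0 := by
    have hc : ContinuousAt γ 0 := (hγ.differentiableAt (hSo.mem_nhds h0)).continuousAt
    have h2 : ∀ᶠ y in 𝓝 (γ 0), y ∉ closure (leaf A ∩ {x | D x ≠ 0}) := by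
      rw [hγ0]; exact isClosed_closure.isOpen_compl.mem_nhds hx
    filter_upwards [hc.eventually h2, hSo.mem_nhds h0] with t ht htS
    by_contra hne
    refine ht (subset_closure ⟨fun i => ?_, hne⟩)
    obtain ⟨G, _, h⟩ := hconj t htS i
    exact ⟨G, h⟩
  have han : AnalyticOnNhd ℂ (fun t => D (γ t)) S :=
    (hD.comp_differentiableOn hγ).analyticOnNhd hSo
  have := han.eqOn_zero_of_preconnected_of_eventuallyEq_zero hSconn h0 hnear h1
  exact hA (by simpa [hγ1] using this)

/-! ### Independence at special points -/

/-- The nilpotent Jordan block `∑ E_{i,i+1}`. -/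
def shiftMatrix (r : ℕ) : Matrix (Fin r) (Fin r) ℂ :=
  Matrix.of fun i j => if j.val = i.val + 1 then 1 else 0

theorem shiftMatrix_apply (i j : Fin r) :
    shiftMatrix r i j = if j.val = i.val + 1 then 1 else 0 := rfl

theorem shiftMatrix_pow_apply (n : ℕ) (i j : Fin r) :
    (shiftMatrix r ^ n) i j = if j.val = i.val + n then 1 else 0 := by
  induction n generalizing j with
  | zero => simp [Matrix.one_apply, Fin.ext_iff, eq_comm]
  | succ n ih =>
    rw [pow_succ, Matrix.mul_apply]
    simp only [ih, shiftMatrix_apply]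
    by_cases h : i.val + n < r
    · rw [Finset.sum_eq_single ⟨i.val + n, h⟩]
      · simp [add_assoc]
      · intro k _ hk
        rw [if_neg fun h' => hk (Fin.ext h'), zero_mul]
      · simp
    · rw [Finset.sum_eq_zero, if_neg (by omega)]
      intro k _
      rw [if_neg (by omega), zero_mul]

theorem shiftMatrix_pow_trace {n : ℕ} (hn : 1 ≤ n) : (shiftMatrix r ^ n).trace = 0 :=
  Finset.sum_eq_zero fun i _ => by
    rw [Matrix.diag_apply, shiftMatrix_pow_apply, if_neg (by omega)]

/-- The nilpotent Jordan block as an element of `sl(r)`. -/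
def shiftSl (r : ℕ) : Sl r :=
  ⟨shiftMatrix r, by
    have := shiftMatrix_pow_trace (r := r) le_rfl
    rwa [pow_one] at this⟩

theorem shiftSl_val : (shiftSl r).val = shiftMatrix r := rfl

/-- The trace-free part of the diagonal matrix `diag (0, 1, …, r - 1)`. -/
noncomputable def gradingSl (r : ℕ) : Sl r := toSl (Matrix.diagonal fun i => (i.val : ℂ))

theorem gradingSl_val : ∃ c : ℂ, (gradingSl r).val = Matrix.diagonal fun i => (i.val : ℂ) - c := by
  refine ⟨(Matrix.diagonal fun i : Fin r => (i.val : ℂ)).trace / (r : ℂ), ?_⟩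
  rw [gradingSl, toSl_val, tracelessPart]
  ext i j
  by_cases h : i = j
  · subst h; simp
  · simp [h]

open Polynomial in
/-- The polynomial giving the entries of the coefficient of `λ ^ k` in `(λ E + D) ^ n`, where `E`
is the Jordan block and `D = diag (0, 1, …) - c`, along the `k`-th upper diagonal. -/
noncomputable def diagonalPoly (c : ℂ) : ℕ → ℕ → ℂ[X]
  | 0, 0 => 1
  | 0, _ + 1 => 0
  | n + 1, 0 => (X + C (-c)) * diagonalPoly c n 0
  | n + 1, k + 1 => diagonalPoly c n k + (X + C ((k : ℂ) + 1 - c)) * diagonalPoly c n (k + 1)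

theorem diagonalPoly_eq_zero (c : ℂ) {n k : ℕ} (h : n < k) : diagonalPoly c n k = 0 := by
  induction n generalizing k with
  | zero =>
    cases k with
    | zero => omega
    | succ k => rfl
  | succ n ih =>
    cases k with
    | zero => omega
    | succ k => rw [diagonalPoly, ih (by omega), ih (by omega)]; simp

theorem natDegree_X_add_C_mul_le (a : ℂ) {p : Polynomial ℂ} {d : ℕ} (h : p.natDegree ≤ d) :
    ((Polynomial.X + Polynomial.C a) * p).natDegree ≤ d + 1 := by
  refine Polynomial.natDegree_mul_le.trans ?_
  rw [Polynomial.natDegree_X_add_C]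
  omega

theorem coeff_X_add_C_mul (a : ℂ) {p : Polynomial ℂ} {d : ℕ} (h : p.natDegree ≤ d) :
    ((Polynomial.X + Polynomial.C a) * p).coeff (d + 1) = p.coeff d := by
  have h0 : p.coeff (d + 1) = 0 := Polynomial.coeff_eq_zero_of_natDegree_lt (by omega)
  rw [add_mul, Polynomial.coeff_add, Polynomial.coeff_X_mul, Polynomial.coeff_C_mul, h0, mul_zero,
    add_zero]

/-- `diagonalPoly c n k` has degree `n - k` and leading coefficient `n.choose k`. -/
theorem diagonalPoly_degree (c : ℂ) (n k d : ℕ) (h : n = k + d) :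
    (diagonalPoly c n k).natDegree ≤ d ∧ (diagonalPoly c n k).coeff d = n.choose k := by
  induction n generalizing k d with
  | zero =>
    obtain ⟨rfl, rfl⟩ : k = 0 ∧ d = 0 := by omega
    simp [diagonalPoly]
  | succ n ih =>
    cases k with
    | zero =>
      obtain ⟨d, rfl⟩ : ∃ e, d = e + 1 := ⟨d - 1, by omega⟩
      obtain ⟨h1, h2⟩ := ih 0 d (by omega)
      rw [diagonalPoly]
      exact ⟨natDegree_X_add_C_mul_le _ h1, by rw [coeff_X_add_C_mul _ h1, h2]; simp⟩
    | succ k =>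
      obtain ⟨h1, h2⟩ := ih k d (by omega)
      rw [diagonalPoly]
      cases d with
      | zero =>
        rw [diagonalPoly_eq_zero c (show n < k + 1 by omega), mul_zero, add_zero]
        refine ⟨h1, ?_⟩
        rw [h2, Nat.choose_succ_succ, Nat.choose_eq_zero_of_lt (show n < k + 1 by omega), add_zero]
      | succ d =>
        obtain ⟨h3, h4⟩ := ih (k + 1) d (by omega)
        refine ⟨Polynomial.natDegree_add_le_of_degree_le h1 (natDegree_X_add_C_mul_le _ h3), ?_⟩
        rw [Polynomial.coeff_add, h2, coeff_X_add_C_mul _ h3, h4, Nat.choose_succ_succ,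
          Nat.cast_add]

theorem mul_shiftMatrix_apply (M : Matrix (Fin r) (Fin r) ℂ) (i j : Fin r) :
    (M * shiftMatrix r) i j = if h : 1 ≤ j.val then M i ⟨j.val - 1, by omega⟩ else 0 := by
  rw [Matrix.mul_apply]
  simp only [shiftMatrix, Matrix.of_apply]
  split_ifs with h
  · rw [Finset.sum_eq_single ⟨j.val - 1, by omega⟩]
    · rw [if_pos (by simp; omega), mul_one]
    · intro k _ hk
      rw [if_neg fun h' => hk (Fin.ext (by simp; omega)), mul_zero]
    · simp
  · exact Finset.sum_eq_zero fun k _ => by rw [if_neg (by omega), mul_zero]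

theorem pencil_shift_diagonal (c : ℂ) (n k : ℕ) (i j : Fin r) :
    pencil (shiftMatrix r) (Matrix.diagonal fun i => (i.val : ℂ) - c) n k i j
      = if j.val = i.val + k then (diagonalPoly c n k).eval (i.val : ℂ) else 0 := by
  induction n generalizing k j with
  | zero =>
    rw [pencil_zero]
    cases k with
    | zero => simp [diagonalPoly, Matrix.one_apply, Fin.ext_iff, eq_comm]
    | succ k => simp [diagonalPoly]
  | succ n ih =>
    rw [pencil_succ_right, Matrix.add_apply, Matrix.mul_diagonal, ih, mul_shiftMatrix_apply]
    cases k with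
    | zero =>
      simp only [pencilShift_zero, Matrix.zero_apply, dite_eq_ite, ite_self, zero_add,
        diagonalPoly, add_zero]
      split_ifs with h
      · rw [h]; simp; ring
      · simp
    | succ k =>
      simp only [pencilShift_succ, diagonalPoly, ih]
      by_cases h : j.val = i.val + (k + 1)
      · rw [dif_pos (by omega), if_pos (by omega), if_pos h, if_pos h, h]
        simp
        ring
      · rw [if_neg h, if_neg h, zero_mul, add_zero]
        split_ifs <;> first | rfl | omega

theorem eq_zero_of_sum_smul_eq_zero (q : ℕ → Polynomial ℂ) (hd : ∀ d, (q d).natDegree ≤ d)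
    (hc : ∀ d, (q d).coeff d ≠ 0) (c : ℕ → ℂ) (m : ℕ)
    (h : ∑ d ∈ Finset.range m, c d • q d = 0) : ∀ d < m, c d = 0 := by
  induction m with
  | zero => intro d hd; omega
  | succ m ih =>
    have h1 := congrArg (fun p => Polynomial.coeff p m) h
    have h2 : ∑ d ∈ Finset.range m, c d * (q d).coeff m = 0 :=
      Finset.sum_eq_zero fun d hd' => by
        rw [Polynomial.coeff_eq_zero_of_natDegree_lt
          ((hd d).trans_lt (Finset.mem_range.1 hd')), mul_zero]
    simp only [Finset.sum_range_succ, Polynomial.coeff_add, Polynomial.finsetSum_coeff,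
      Polynomial.coeff_smul, smul_eq_mul, Polynomial.coeff_zero] at h1
    rw [h2, zero_add] at h1
    have h3 : c m = 0 := (mul_eq_zero.1 h1).resolve_right (hc m)
    rw [Finset.sum_range_succ, h3, zero_smul, add_zero] at h
    intro d hd'
    rcases Nat.lt_succ_iff_lt_or_eq.1 hd' with h' | rfl
    · exact ih h d h'
    · exact h3

/-- For fixed `k` the polynomials `diagonalPoly c n k`, `k ≤ n < r`, have the distinct degrees
`0, …, r - k - 1`, so a combination vanishing at `r - k` points is trivial. -/
theorem sum_diagonalPoly_eq_zero (c : ℂ) (k : ℕ) (u : ℕ → ℂ)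
    (h : ∀ i, i + k < r → ∑ n ∈ Finset.range r, u n * (diagonalPoly c n k).eval (i : ℂ) = 0) :
    ∀ n, k ≤ n → n < r → u n = 0 := by
  by_cases hk : k < r
  swap
  · intro n h1 h2; omega
  obtain ⟨m, rfl⟩ : ∃ m, r = k + m := ⟨r - k, by omega⟩
  let q : ℕ → Polynomial ℂ := fun d => diagonalPoly c (k + d) k
  have hq := fun d => diagonalPoly_degree c (k + d) k d rfl
  have h0 : ∑ d ∈ Finset.range m, u (k + d) • q d = 0 := by
    refine Polynomial.eq_zero_of_natDegree_lt_card_of_eval_eq_zero' _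
      ((Finset.range m).image fun i : ℕ => (i : ℂ)) ?_ ?_
    · intro x hx
      obtain ⟨i, hi, rfl⟩ := Finset.mem_image.1 hx
      have h1 := h i (by have := Finset.mem_range.1 hi; omega)
      rw [Finset.sum_range_add, Finset.sum_eq_zero, zero_add] at h1
      · simpa [Polynomial.eval_finsetSum, q] using h1
      · intro n hn
        rw [diagonalPoly_eq_zero c (Finset.mem_range.1 hn)]; simp
    · rw [Finset.card_image_of_injective _ Nat.cast_injective, Finset.card_range]
      refine (Polynomial.natDegree_sum_le_of_forall_le (n := m - 1) _ _ fun d hd => ?_).trans_lt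
        (by omega)
      refine (Polynomial.natDegree_smul_le _ _).trans ((hq d).1.trans ?_)
      have := Finset.mem_range.1 hd
      omega
  intro n h1 h2
  have := eq_zero_of_sum_smul_eq_zero q (fun d => (hq d).1) (fun d => by
    rw [(hq d).2]
    exact_mod_cast (Nat.choose_pos (by omega)).ne') (fun d => u (k + d)) m h0 (n - k) (by omega)
  rwa [show k + (n - k) = n by omega] at this

theorem linearIndependent_sigma_iff {W : Type*} [AddCommGroup W] [Module ℂ W] (m s : ℕ)
    (V : ℕ → ℕ → W) :
    LinearIndependent ℂ (fun x : Σ b : Fin m, Fin (b.val + s) => V x.1.val x.2.val) ↔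
      ∀ c : ℕ → ℕ → ℂ, ∑ n ∈ Finset.range m, ∑ k ∈ Finset.range (n + s), c n k • V n k = 0 →
        ∀ n < m, ∀ k < n + s, c n k = 0 := by
  have hsum : ∀ c : ℕ → ℕ → ℂ,
      ∑ x : Σ b : Fin m, Fin (b.val + s), c x.1.val x.2.val • V x.1.val x.2.val
        = ∑ n ∈ Finset.range m, ∑ k ∈ Finset.range (n + s), c n k • V n k := fun c => by
    rw [Fintype.sum_sigma, ← Fin.sum_univ_eq_sum_range
      (fun n => ∑ k ∈ Finset.range (n + s), c n k • V n k)]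
    exact Finset.sum_congr rfl fun b _ =>
      Fin.sum_univ_eq_sum_range (fun k => c b.val k • V b.val k) _
  rw [Fintype.linearIndependent_iff]
  constructor
  · intro h c hc n hn k hk
    exact h (fun x => c x.1.val x.2.val) ((hsum c).trans hc) ⟨⟨n, hn⟩, ⟨k, hk⟩⟩
  · intro h g hg x
    let c : ℕ → ℕ → ℂ := fun n k =>
      if h : ∃ hn : n < m, k < n + s then g ⟨⟨n, h.1⟩, ⟨k, h.2⟩⟩ else 0
    have hcg : ∀ x : Σ b : Fin m, Fin (b.val + s), c x.1.val x.2.val = g x := fun x => by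
      simp only [c]
      rw [dif_pos ⟨x.1.isLt, x.2.isLt⟩]
    rw [← hcg]
    refine h c ?_ _ x.1.isLt _ x.2.isLt
    rw [← hsum, ← hg]
    exact Finset.sum_congr rfl fun x _ => by rw [hcg]

/-- The gradients of the coefficients of `tr (λ a + b) ^ β`, `2 ≤ β ≤ r`, up to factors: the
trace-free parts of the coefficients of `(λ a + b) ^ n`, `1 ≤ n ≤ r - 1`. -/
noncomputable def pencilFamily (a b : Matrix (Fin r) (Fin r) ℂ) :
    (Σ b : Fin (r - 1), Fin (b.val + 2)) → Sl r :=
  fun x => toSl (pencil a b (x.1.val + 1) x.2.val)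

/-- The coefficients of the powers of a generic pencil are linearly independent modulo scalars:
this holds for the pencil spanned by the Jordan block and the grading element. -/
theorem linearIndependent_pencilFamily :
    LinearIndependent ℂ (pencilFamily (shiftSl r).val (gradingSl r).val) := by
  obtain ⟨c, hc⟩ := gradingSl_val (r := r)
  rw [hc, shiftSl_val]
  refine (linearIndependent_sigma_iff (r - 1) 2 fun n k => toSl (pencil (shiftMatrix r)
    (Matrix.diagonal fun i => (i.val : ℂ) - c) (n + 1) k)).2 fun u hu n hn k hk => ?_
  set P := pencil (shiftMatrix r) (Matrix.diagonal fun i => (i.val : ℂ) - c) with hP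
  set M := ∑ n ∈ Finset.range (r - 1), ∑ k ∈ Finset.range (n + 2), u n k • P (n + 1) k with hM
  have hM0 : tracelessPart M = 0 := by
    have : toSlLin r M = 0 := by
      rw [← hu, hM, map_sum]
      refine Finset.sum_congr rfl fun n _ => ?_
      rw [map_sum]
      refine Finset.sum_congr rfl fun k _ => ?_
      rw [map_smul]; rfl
    exact congrArg Subtype.val this
  set μ := M.trace / (r : ℂ) with hμ
  have hMμ : M = μ • 1 := sub_eq_zero.1 hM0
  -- The scalar `μ` plays the role of a coefficient of the power with exponent `0`.
  let v : ℕ → ℂ := fun n => if n = 0 then (if k = 0 then -μ else 0)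
    else if k < n + 1 then u (n - 1) k else 0
  have hv := sum_diagonalPoly_eq_zero (r := r) c k v ?_ (n + 1) (by omega) (by omega)
  · simpa [v, show k ≤ n + 1 by omega] using hv
  intro i hi
  have hMij := congrFun (congrFun hMμ ⟨i, by omega⟩) ⟨i + k, hi⟩
  rw [hM, Matrix.sum_apply, Matrix.smul_apply, Matrix.one_apply] at hMij
  have hin : ∀ n ∈ Finset.range (r - 1),
      (∑ k ∈ Finset.range (n + 2), u n k • P (n + 1) k) (⟨i, by omega⟩ : Fin r) ⟨i + k, hi⟩
        = v (n + 1) * (diagonalPoly c (n + 1) k).eval (i : ℂ) := fun n _ => by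
    rw [Matrix.sum_apply]
    simp only [Matrix.smul_apply, hP, pencil_shift_diagonal, add_right_inj]
    by_cases hkn : k < n + 2
    · rw [Finset.sum_eq_single k]
      · simp [v, show k ≤ n + 1 by omega]
      · intro k' _ hk'
        rw [if_neg hk'.symm, smul_zero]
      · intro h; exact absurd (Finset.mem_range.2 hkn) h
    · rw [Finset.sum_eq_zero, diagonalPoly_eq_zero c (by omega)]
      · simp
      · intro k' hk'
        rw [if_neg (by have := Finset.mem_range.1 hk'; omega), smul_zero]
  rw [Finset.sum_congr rfl hin] at hMij
  rw [show r = r - 1 + 1 by omega, Finset.sum_range_succ', hMij]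
  rcases Nat.eq_zero_or_pos k with rfl | hk0
  · simp [v, diagonalPoly]
  · rw [diagonalPoly_eq_zero c hk0]
    simp [Fin.ext_iff, hk0.ne']

/-- The gradients of the invariants and of the Cartan and Gel'fand–Cetlin functions on
`sl(r)`. -/
noncomputable def cetlinFamily (X : Matrix (Fin r) (Fin r) ℂ) :
    Fin (r - 1) ⊕ (CartanIdx r ⊕ GCIdx r) → Sl r :=
  Sum.elim (fun b => toSl (X ^ (b.val + 1))) (fun s => toSl (extraGrad r s X))

theorem corner_shiftMatrix {m : ℕ} (hm : m ≤ r) : corner hm (shiftMatrix r) = shiftMatrix m := by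
  have : (shiftMatrix r).submatrix (Fin.castLE hm) (Fin.castLE hm) = shiftMatrix m := by
    ext i j; simp [shiftMatrix]
  rw [corner, this, tracelessPart_of_trace_eq_zero]
  have := shiftMatrix_pow_trace (r := m) le_rfl
  rwa [pow_one] at this

theorem cornerIncl_mul_mul_apply {m : ℕ} (hm : m ≤ r) (S : Matrix (Fin m) (Fin m) ℂ)
    (i j : Fin r) :
    (cornerIncl hm * S * (cornerIncl hm).transpose) i j
      = if h : i.val < m ∧ j.val < m then S ⟨i, h.1⟩ ⟨j, h.2⟩ else 0 := by
  have h1 : ∀ (k : Fin r) (a : Fin m), k = Fin.castLE hm a ↔ k.val = a.val := fun k a => by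
    simp [Fin.ext_iff]
  simp only [Matrix.mul_apply, cornerIncl, Matrix.of_apply, Matrix.transpose_apply, h1]
  split_ifs with h
  · rw [Finset.sum_eq_single ⟨j.val, h.2⟩]
    · rw [Finset.sum_eq_single ⟨i.val, h.1⟩]
      · simp
      · intro k _ hk
        rw [if_neg fun h' => hk (Fin.ext h'.symm), zero_mul]
      · simp
    · intro k _ hk
      rw [if_neg fun h' => hk (Fin.ext h'.symm), mul_zero]
    · simp
  · rw [not_and_or] at h
    refine Finset.sum_eq_zero fun a _ => ?_
    rcases h with h | h
    · rw [Finset.sum_eq_zero, zero_mul]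
      intro b _
      rw [if_neg (by omega), zero_mul]
    · rw [if_neg (by omega), mul_zero]

theorem cornerGrad_shiftMatrix_apply {m : ℕ} (hm : m ≤ r) (n : ℕ) (i j : Fin r) :
    cornerGrad hm (n + 2) (shiftMatrix r) i j
      = if j.val < m ∧ j.val = i.val + (n + 1) then ((n + 2 : ℕ) : ℂ) else 0 := by
  rw [cornerGrad, corner_shiftMatrix, tracelessPart_of_trace_eq_zero
    (shiftMatrix_pow_trace (by omega)), Matrix.smul_apply, cornerIncl_mul_mul_apply]
  simp only [shiftMatrix_pow_apply]
  split_ifs <;> first | omega | simp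

theorem cartanMatrix_trace (k : Fin (r - 1)) : (cartanMatrix k).trace = 0 := by
  have h : ∀ n, n < r → ∑ i : Fin r, (if i.val = n then (1 : ℂ) else 0) = 1 := fun n hn => by
    rw [Finset.sum_eq_single ⟨n, hn⟩]
    · simp
    · intro i _ hi
      rw [if_neg fun h => hi (Fin.ext h)]
    · simp
  rw [cartanMatrix, Matrix.trace_diagonal, Finset.sum_sub_distrib, h _ (by omega), h _ (by omega),
    sub_self]

/-- On the Jordan block the Gel'fand–Cetlin gradients are truncated powers of the block, and so
linearly independent. -/
theorem linearIndependent_cetlinFamily : LinearIndependent ℂ (cetlinFamily (shiftSl r).val) := by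
  rw [Fintype.linearIndependent_iff]
  intro g hg
  rw [Fintype.sum_sum_type, Fintype.sum_sum_type] at hg
  let M : Matrix (Fin r) (Fin r) ℂ := ∑ b : Fin (r - 1), g (Sum.inl b) • shiftMatrix r ^ (b.val + 1)
    + (∑ k : CartanIdx r, g (Sum.inr (Sum.inl k)) • cartanMatrix k
      + ∑ s : GCIdx r, g (Sum.inr (Sum.inr s))
        • cornerGrad (Nat.add_lt_of_lt_sub s.1.isLt).le (s.2.val + 2) (shiftMatrix r))
  have hM0 : tracelessPart M = 0 := by
    have : toSlLin r M = 0 := by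
      rw [← hg]
      simp only [M, map_add, map_sum, map_smul]
      rfl
    exact congrArg Subtype.val this
  have hoff : ∀ (n : ℕ) (i j : Fin r), j.val = i.val + (n + 1) →
      ∑ b : Fin (r - 1), g (Sum.inl b) * (if b.val = n then 1 else 0)
        + ∑ s : GCIdx r, g (Sum.inr (Sum.inr s))
          * (if j.val < s.1.val + 2 ∧ s.2.val = n then ((n + 2 : ℕ) : ℂ) else 0) = 0 := by
    intro n i j hij
    have h1 := congrFun (congrFun hM0 i) j
    have hne : i ≠ j := fun h => by rw [h] at hij; omega
    rw [tracelessPart, Matrix.sub_apply, Matrix.smul_apply, Matrix.one_apply_ne hne, smul_zero,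
      sub_zero] at h1
    simp only [M, Matrix.add_apply, Matrix.sum_apply, Matrix.smul_apply, shiftMatrix_pow_apply,
      cornerGrad_shiftMatrix_apply, cartanMatrix, Matrix.diagonal_apply_ne _ hne, smul_eq_mul,
      mul_zero, Finset.sum_const_zero, zero_add, Matrix.zero_apply] at h1
    refine Eq.trans ?_ h1
    congr 1
    · refine Finset.sum_congr rfl fun b _ => ?_
      congr 1
      exact if_congr (by omega) rfl rfl
    · refine Finset.sum_congr rfl fun s _ => ?_
      congr 1
      split_ifs with h2 h3 h3
      · rw [h2.2]
      · omega
      · omega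
      · rfl
  have hy : ∀ s : GCIdx r, g (Sum.inr (Sum.inr s)) = 0 := by
    rintro ⟨m, k⟩
    have hm := m.isLt
    have hk := k.isLt
    have h1 := hoff k.val ⟨m.val - k.val, by omega⟩ ⟨m.val + 1, by omega⟩ (by simp; omega)
    have h2 := hoff k.val ⟨m.val - k.val + 1, by omega⟩ ⟨m.val + 2, by omega⟩ (by simp; omega)
    -- Passing from one entry of the diagonal to the next only loses the block of size `m + 2`.
    have h3 := sub_eq_zero.2 (h1.trans h2.symm)
    rw [add_sub_add_left_eq_sub, ← Finset.sum_sub_distrib, Finset.sum_eq_single ⟨m, k⟩] at h3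
    · have h4 : (k.val : ℂ) + 2 ≠ 0 := by exact_mod_cast (by omega : k.val + 2 ≠ 0)
      simpa [h4] using h3
    · rintro ⟨m', k'⟩ _ hne
      rw [← mul_sub]
      have : ¬ (m' = m ∧ k'.val = k.val) := by
        rintro ⟨rfl, h⟩
        exact hne (by rw [Fin.ext h])
      have h5 : ¬ (m'.val = m.val ∧ k'.val = k.val) := fun h => this ⟨Fin.ext h.1, h.2⟩
      simp only
      split_ifs <;> first | omega | simp
    · simp
  have ha : ∀ b : Fin (r - 1), g (Sum.inl b) = 0 := by
    intro b
    have hb := b.isLt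
    have h1 := hoff b.val ⟨r - 1 - (b.val + 1), by omega⟩ ⟨r - 1, by omega⟩
      (by change r - 1 = r - 1 - (b.val + 1) + (b.val + 1); omega)
    rw [Finset.sum_eq_zero (s := Finset.univ (α := GCIdx r)) fun s _ => by rw [hy, zero_mul],
      add_zero, Finset.sum_eq_single b] at h1
    · simpa using h1
    · intro b' _ hb'
      rw [if_neg fun h => hb' (Fin.ext h), mul_zero]
    · simp
  have hx : ∑ k : CartanIdx r, g (Sum.inr (Sum.inl k)) • cartanMatrix k = 0 := by
    have hM : M = ∑ k : CartanIdx r, g (Sum.inr (Sum.inl k)) • cartanMatrix k := by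
      simp [M, ha, hy]
    rw [← hM, ← hM0, tracelessPart_of_trace_eq_zero]
    rw [hM, Matrix.trace_sum]
    exact Finset.sum_eq_zero fun k _ => by rw [Matrix.trace_smul, cartanMatrix_trace, smul_zero]
  have hxk : ∀ n, ∀ k : CartanIdx r, k.val = n → g (Sum.inr (Sum.inl k)) = 0 := by
    intro n
    induction n using Nat.strong_induction_on with
    | _ n ih =>
      intro k hk
      have h1 := congrFun (congrFun hx ⟨k.val, by omega⟩) ⟨k.val, by omega⟩
      rw [Matrix.sum_apply, Finset.sum_eq_single k] at h1
      · simpa [cartanMatrix] using h1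
      · intro k' _ hk'
        have hne : k'.val ≠ k.val := fun h => hk' (Fin.ext h)
        rcases lt_or_gt_of_ne hne with h | h
        · rw [ih k'.val (by omega) k' rfl]; simp
        · simp only [Matrix.smul_apply, cartanMatrix, Matrix.diagonal_apply_eq]
          rw [if_neg (by omega), if_neg (by omega)]; simp
      · simp
  rintro (b | k | s)
  · exact ha b
  · exact hxk _ k rfl
  · exact hy s

/-! ### Dimensions -/

theorem finrank_sl (hr : 1 ≤ r) : Module.finrank ℂ (Sl r) + 1 = r * r := by
  have h := LinearMap.finrank_range_add_finrank_ker (Matrix.traceLinearMap (Fin r) ℂ ℂ)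
  have hs : LinearMap.range (Matrix.traceLinearMap (Fin r) ℂ ℂ) = ⊤ := by
    rw [LinearMap.range_eq_top]
    intro c
    refine ⟨Matrix.single ⟨0, hr⟩ ⟨0, hr⟩ c, ?_⟩
    simp
  rw [hs, finrank_top, Module.finrank_self, Module.finrank_matrix, Fintype.card_fin,
    Module.finrank_self, mul_one, add_comm] at h
  exact h

theorem finrank_phase (hr : 1 ≤ r) : Module.finrank ℂ (Phase N r) + N = N * (r * r) := by
  rw [Module.finrank_pi_fintype, Finset.sum_const, Finset.card_univ, Fintype.card_fin,
    smul_eq_mul, ← finrank_sl hr]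
  ring

theorem shiftMatrix_mul_apply (M : Matrix (Fin r) (Fin r) ℂ) (i j : Fin r) :
    (shiftMatrix r * M) i j = if h : i.val + 1 < r then M ⟨i.val + 1, h⟩ j else 0 := by
  rw [Matrix.mul_apply]
  simp only [shiftMatrix_apply]
  split_ifs with h
  · rw [Finset.sum_eq_single ⟨i.val + 1, h⟩]
    · simp
    · intro k _ hk
      rw [if_neg fun h' => hk (Fin.ext h'), zero_mul]
    · simp
  · exact Finset.sum_eq_zero fun k _ => by rw [if_neg (by omega), zero_mul]

/-- A trace-free matrix that commutes with the Jordan block is determined by its last column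
without the last entry. -/
theorem eq_zero_of_commute_shiftMatrix {Y : Matrix (Fin r) (Fin r) ℂ} (ht : Y.trace = 0)
    (hc : shiftMatrix r * Y = Y * shiftMatrix r)
    (h0 : ∀ i j : Fin r, i.val + 1 < r → j.val + 1 = r → Y i j = 0) : Y = 0 := by
  rcases Nat.eq_zero_or_pos r with rfl | hr
  · exact Subsingleton.elim _ _
  set y := Y ⟨r - 1, by omega⟩ ⟨r - 1, by omega⟩ with hy
  have key : ∀ d, ∀ i j : Fin r, j.val + d + 1 = r → Y i j = if i = j then y else 0 := by
    intro d
    induction d with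
    | zero =>
      intro i j hj
      split_ifs with h
      · subst h
        rw [hy]
        congr 1 <;> exact Fin.ext (by simp; omega)
      · have : i.val ≠ j.val := fun h' => h (Fin.ext h')
        exact h0 i j (by omega) (by omega)
    | succ d ih =>
      intro i j hj
      have h := congrFun (congrFun hc i) ⟨j.val + 1, by omega⟩
      rw [shiftMatrix_mul_apply, mul_shiftMatrix_apply,
        dif_pos (c := 1 ≤ (⟨j.val + 1, by omega⟩ : Fin r).val) (by simp)] at h
      simp only [Nat.add_sub_cancel, Fin.eta] at h
      rw [← h]
      split_ifs with h1 h2 h2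
      · rw [ih _ _ (by simp; omega), if_pos (by simp [h2])]
      · rw [ih _ _ (by simp; omega), if_neg (by simpa [Fin.ext_iff] using h2)]
      · subst h2; omega
      · rfl
  have key' : ∀ i j : Fin r, Y i j = if i = j then y else 0 := fun i j =>
    key (r - 1 - j.val) i j (by omega)
  have hy0 : y = 0 := by
    rw [Matrix.trace] at ht
    simp only [Matrix.diag_apply, key', if_true] at ht
    rw [Finset.sum_const, Finset.card_univ, Fintype.card_fin, nsmul_eq_mul] at ht
    exact (mul_eq_zero.1 ht).resolve_left (by exact_mod_cast hr.ne')
  ext i j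
  rw [key', hy0, ite_self]; rfl

/-- The Jordan block is regular. -/
theorem finrank_ker_tensorP_shift :
    Module.finrank ℂ (LinearMap.ker (tensorP (fun _ : Fin N => shiftSl r))) ≤ N * (r - 1) := by
  let f : LinearMap.ker (tensorP (fun _ : Fin N => shiftSl r)) →ₗ[ℂ] (Fin N → Fin (r - 1) → ℂ) :=
    LinearMap.pi fun i => LinearMap.pi fun k =>
      (Matrix.entryLinearMap ℂ ℂ (⟨k.val, by omega⟩ : Fin r)
        (⟨r - 1, by have := k.isLt; omega⟩ : Fin r)) ∘ₗ
        slIncl r ∘ₗ compLin i ∘ₗ Submodule.subtype _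
  have hf : Function.Injective f := by
    rw [← LinearMap.ker_eq_bot, LinearMap.ker_eq_bot']
    intro ξ hξ
    have hcomp : ∀ i, (comp ξ.val i).val = 0 := fun i => by
      refine eq_zero_of_commute_shiftMatrix (sl_trace _) ?_ fun a b ha hb => ?_
      · have h := congrFun (LinearMap.mem_ker.1 ξ.2) i
        rw [tensorP_apply] at h
        exact sub_eq_zero.1 (congrArg Subtype.val h)
      · have h := congrFun (congrFun hξ i) ⟨a.val, by omega⟩
        have hb' : b = ⟨r - 1, by omega⟩ := Fin.ext (by simp; omega)
        rw [hb']
        exact h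
    apply Subtype.ext
    rw [← trForm_comp ξ.val]
    ext j V
    simp [hcomp, trForm_apply]
  have h := LinearMap.finrank_le_finrank_of_injective hf
  rw [Module.finrank_pi_fintype] at h
  simpa using h

/-- `P ξ` as a linear function of the point. -/
noncomputable def tensorPLin (ξ : Module.Dual ℂ (Phase N r)) : Phase N r →ₗ[ℂ] Phase N r where
  toFun A := tensorP A ξ
  map_add' A B := by funext i; simp [tensorP_apply]
  map_smul' c A := by funext i; simp [tensorP_apply]

theorem finrank_range_add_ker (A : Phase N r) :
    Module.finrank ℂ (LinearMap.range (tensorP A)) + Module.finrank ℂ (LinearMap.ker (tensorP A))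
      = Module.finrank ℂ (Phase N r) := by
  rw [LinearMap.finrank_range_add_finrank_ker, Subspace.dual_finrank_eq]

/-- Generically the corank of `P` is at most `N (r - 1)`. -/
theorem exists_corank_bound (N r : ℕ) : ∃ D : Phase N r → ℂ, Differentiable ℂ D ∧
    (∃ A, D A ≠ 0) ∧
    ∀ A, D A ≠ 0 → Module.finrank ℂ (LinearMap.ker (tensorP A)) ≤ N * (r - 1) := by
  set A₀ : Phase N r := fun _ => shiftSl r with hA₀
  let b := Module.finBasis ℂ (LinearMap.range (tensorP A₀))
  have hb : ∀ k, ∃ ξ, tensorP A₀ ξ = (b k).val := fun k => (b k).2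
  choose ξ hξ using hb
  have hli : LinearIndependent ℂ fun k => tensorP A₀ (ξ k) := by
    simp only [hξ]
    exact b.linearIndependent.map' (Submodule.subtype _) (Submodule.ker_subtype _)
  obtain ⟨D, hD, hD0, h⟩ := exists_minor (fun k A => tensorPLin (ξ k) A)
    (fun k => differentiable_linearMap _) A₀ hli
  refine ⟨D, hD, ⟨A₀, hD0⟩, fun A hA => ?_⟩
  have h1 : LinearIndependent ℂ fun k =>
      (⟨tensorP A (ξ k), LinearMap.mem_range_self _ _⟩ : LinearMap.range (tensorP A)) :=
    LinearIndependent.of_comp (Submodule.subtype _) (h A hA)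
  have h2 := h1.fintype_card_le_finrank
  rw [Fintype.card_fin] at h2
  have h3 := finrank_range_add_ker A
  have h4 := finrank_range_add_ker A₀
  have h5 := finrank_ker_tensorP_shift (N := N) (r := r)
  rw [← hA₀] at h5
  omega

/-! ### Generic points -/

theorem differentiable_pencilFamily (l : Fin N) (x : Σ b : Fin (r - 1), Fin (b.val + 2)) :
    Differentiable ℂ fun A : Phase N r => pencilFamily (A l).val (partialSum A l).val x := by
  have h := differentiable_linear_pencil (siteLin (r := r) l) (partialSumLin l) (toSlLin r)
    (x.1.val + 1) x.2.val
  simp only [partialSumLin_apply] at h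
  exact h

/-- The embedding of the `m × m` matrices as upper left blocks, as a linear map. -/
noncomputable def cornerEmbed {m : ℕ} (hm : m ≤ r) :
    Matrix (Fin m) (Fin m) ℂ →ₗ[ℂ] Matrix (Fin r) (Fin r) ℂ where
  toFun W := cornerIncl hm * W * (cornerIncl hm).transpose
  map_add' V W := by rw [Matrix.mul_add, Matrix.add_mul]
  map_smul' c W := by rw [Matrix.mul_smul, Matrix.smul_mul]; rfl

theorem differentiable_cetlinFamily (x : Fin (r - 1) ⊕ (CartanIdx r ⊕ GCIdx r)) :
    Differentiable ℂ fun A : Phase N r => cetlinFamily (total A).val x := by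
  rcases x with b | k | s
  · have h := differentiable_linear_pencil (totalLin (N := N)) 0 (toSlLin r)
      (b.val + 1) (b.val + 1)
    simp only [pencil_self, totalLin_apply] at h
    exact h
  · change Differentiable ℂ fun _ : Phase N r => toSl (cartanMatrix k)
    exact differentiable_const _
  · have hm : s.1.val + 2 ≤ r := (Nat.add_lt_of_lt_sub s.1.isLt).le
    have h := differentiable_linear_pencil (cornerLin hm ∘ₗ totalLin (N := N)) 0
      (((s.2.val + 2 : ℕ) : ℂ) • (toSlLin r ∘ₗ cornerEmbed hm ∘ₗ slIncl _ ∘ₗ toSlLin _))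
      (s.2.val + 1) (s.2.val + 1)
    simp only [pencil_self, LinearMap.comp_apply, totalLin_apply, LinearMap.smul_apply,
      ← map_smul (toSlLin r)] at h
    exact h

/-- The pencil at the site `l.succ` can be prescribed: here `A` is the Jordan block and `B` the
grading element. -/
theorem exists_point_pencil {M : ℕ} (l : Fin M) :
    ∃ A : Phase (M + 1) r, A l.succ = shiftSl r ∧ partialSum A l.succ = gradingSl r := by
  refine ⟨fun i => if i = 0 then gradingSl r else if i = l.succ then shiftSl r else 0, ?_, ?_⟩
  · simp [Fin.succ_ne_zero l]
  · rw [partialSum, Finset.sum_eq_single 0]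
    · simp
    · intro i hi h0
      simp [h0, (Finset.mem_filter.1 hi).2.ne]
    · intro h
      exact absurd (Finset.mem_filter.2 ⟨Finset.mem_univ (0 : Fin (M + 1)), Fin.succ_pos l⟩) h

theorem exists_pencil_minor {M : ℕ} (l : Fin M) : ∃ D : Phase (M + 1) r → ℂ,
    Differentiable ℂ D ∧ (∃ A, D A ≠ 0) ∧ ∀ A, D A ≠ 0 →
      LinearIndependent ℂ (pencilFamily (A l.succ).val (partialSum A l.succ).val) := by
  obtain ⟨A₀, h1, h2⟩ := exists_point_pencil (r := r) l
  have h0 : LinearIndependent ℂ (pencilFamily (A₀ l.succ).val (partialSum A₀ l.succ).val) := by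
    rw [h1, h2]; exact linearIndependent_pencilFamily
  obtain ⟨D, hD, hD0, h⟩ := exists_minor (E := Phase (M + 1) r)
    (fun x A => pencilFamily (A l.succ).val (partialSum A l.succ).val x)
    (fun x => differentiable_pencilFamily l.succ x) A₀ h0
  exact ⟨D, hD, ⟨A₀, hD0⟩, h⟩

theorem exists_cetlin_minor (M r : ℕ) : ∃ D : Phase (M + 1) r → ℂ,
    Differentiable ℂ D ∧ (∃ A, D A ≠ 0) ∧ ∀ A, D A ≠ 0 →
      LinearIndependent ℂ (cetlinFamily (total A).val) := by
  let A₀ : Phase (M + 1) r := Pi.single 0 (shiftSl r)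
  have h1 : total A₀ = shiftSl r := by
    rw [total, Finset.sum_eq_single 0]
    · simp [A₀]
    · intro i _ h0
      simp [A₀, h0]
    · simp
  obtain ⟨D, hD, hD0, h⟩ := exists_minor
    (fun x A => cetlinFamily (total A).val x)
    (fun x => differentiable_cetlinFamily x) A₀
    (by rw [h1]; exact linearIndependent_cetlinFamily)
  exact ⟨D, hD, ⟨A₀, hD0⟩, h⟩

/-! ### Independence of the differentials -/

/-- Summation by parts, without a boundary term at the upper end because `T (m + 1) = 0`. -/
theorem sum_smul_shift {V : Type*} [AddCommGroup V] [Module ℂ V] (a : ℂ) (u : ℕ → ℂ) (T : ℕ → V)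
    (m : ℕ) (hT : T (m + 1) = 0) :
    ∑ k ∈ Finset.range (m + 1), ((if k = 0 then a else u (k - 1)) - u k) • T k
      = a • T 0 + ∑ k ∈ Finset.range (m + 1), u k • T (k + 1)
        - ∑ k ∈ Finset.range (m + 1), u k • T k := by
  simp only [sub_smul, Finset.sum_sub_distrib]
  congr 1
  rw [Finset.sum_range_succ', Finset.sum_range_succ _ m, hT]
  simp [add_comm]

/-- The sum of the sites with number at most `n`. -/
noncomputable def headSum (A : Phase N r) (n : ℕ) : Matrix (Fin r) (Fin r) ℂ :=
  ∑ i ∈ Finset.univ.filter (fun i : Fin N => i.val ≤ n), (A i).val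

theorem headSum_zero {M : ℕ} (A : Phase (M + 1) r) : headSum A 0 = (A 0).val := by
  rw [headSum, Finset.sum_filter, Finset.sum_eq_single 0]
  · simp
  · intro i _ hi
    rw [if_neg]
    intro h
    exact hi (Fin.ext (by simpa using h))
  · simp

theorem headSum_eq_partialSum {M : ℕ} (A : Phase (M + 1) r) (l : Fin M) :
    headSum A l.val = (partialSum A l.succ).val := by
  rw [headSum, partialSum_val]
  congr 1
  ext i
  simp [Fin.lt_def]

theorem headSum_succ {M : ℕ} (A : Phase (M + 1) r) (l : Fin M) :
    headSum A (l.val + 1) = (A l.succ).val + (partialSum A l.succ).val := by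
  rw [partialSum_val, headSum, ← Finset.sum_insert (f := fun i => (A i).val) (by simp)]
  congr 1
  ext i
  simp [Fin.lt_def, Fin.ext_iff, Nat.le_iff_lt_or_eq, or_comm]

theorem headSum_last {M : ℕ} (A : Phase (M + 1) r) : headSum A M = (total A).val := by
  rw [total_val, headSum, Finset.filter_true_of_mem]
  intro i _
  omega

theorem comp_sum {ι : Type*} (s : Finset ι) (ξ : ι → Module.Dual ℂ (Phase N r)) (j : Fin N) :
    comp (∑ i ∈ s, ξ i) j = ∑ i ∈ s, comp (ξ i) j := map_sum (compLin j) ξ s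

/-- If the pencils `λ A_l + B_l` and the total `A_tot` are generic, then the differentials of the
whole family are linearly independent. Comparing the components of a linear relation at
consecutive sites, the generic pencil forces all its coefficients at the later site to be equal
to the coefficient `a b` of the Casimir of the first site; the relation then takes the same form
with the sum of one site more, and at the last site it is a relation on `A_tot`. -/
theorem linearIndependent_diff_fullFamily {M : ℕ} (A : Phase (M + 1) r)
    (hpencil : ∀ l : Fin M,
      LinearIndependent ℂ (pencilFamily (A l.succ).val (partialSum A l.succ).val))
    (hcetlin : LinearIndependent ℂ (cetlinFamily (total A).val)) :
    LinearIndependent ℂ fun s => diff (fullFamily (M + 1) r s) A := by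
  rw [Fintype.linearIndependent_iff]
  intro g hg
  let a : Fin (r - 1) → ℂ := fun b => g (Sum.inl (0, b))
  let κ : Fin M → Fin (r - 1) → ℕ → ℂ := fun l b k =>
    if h : k < b.val + 1 then g (Sum.inr (Sum.inl (l, ⟨b, ⟨k, h⟩⟩))) else g (Sum.inl (l.succ, b))
  let T : Fin M → Fin (r - 1) → ℕ → Sl r := fun l b k =>
    toSl (pencil (A l.succ).val (partialSum A l.succ).val (b.val + 1) k)
  let Z : Fin M → Sl r := fun l =>
    ∑ b, ((b.val + 2 : ℕ) : ℂ) • ∑ k ∈ Finset.range (b.val + 2), κ l b k • T l b (k + 1)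
  let W : Fin M → Sl r := fun l =>
    ∑ b, ((b.val + 2 : ℕ) : ℂ) • ∑ k ∈ Finset.range (b.val + 2), κ l b k • T l b k
  let Y : Sl r := ∑ s, g (Sum.inr (Sum.inr s)) • toSl (extraGrad r s (total A).val)
  -- The component of the relation at the site `j`.
  have hrel : ∀ j : Fin (M + 1),
      ∑ b, a b • toSl (gradH (b.val + 2) (b.val + 2) 0 A j)
        + ∑ l : Fin M, ∑ b : Fin (r - 1), ∑ k ∈ Finset.range (b.val + 2),
            κ l b k • toSl (gradH (k + 1) (b.val + 2) l.succ A j) + Y = 0 := by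
    intro j
    have h1 := congrArg (fun ξ => comp ξ j) hg
    simp only [comp_sum, comp_smul] at h1
    rw [Fintype.sum_sum_type, Fintype.sum_sum_type, ← add_assoc] at h1
    refine Eq.trans ?_ (h1.trans (map_zero (compLin j)))
    congr 1
    · rw [Fintype.sum_prod_type, Fin.sum_univ_succ, add_assoc]
      congr 1
      · refine Finset.sum_congr rfl fun b _ => ?_
        change _ = _ • comp (diff (casimir (b.val + 2) 0) A) j
        rw [casimir_eq, diff_lenardH, comp_trForm]
      · rw [Fintype.sum_prod_type]
        change _ = _ + ∑ l : Fin M, _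
        rw [← Finset.sum_add_distrib]
        refine Finset.sum_congr rfl fun l _ => ?_
        rw [Fintype.sum_sigma, ← Finset.sum_add_distrib]
        refine Finset.sum_congr rfl fun b _ => ?_
        rw [Finset.sum_range_succ, add_comm]
        congr 1
        · change _ = _ • comp (diff (casimir (b.val + 2) l.succ) A) j
          rw [casimir_eq, diff_lenardH, comp_trForm]
          simp [κ]
        · rw [← Fin.sum_univ_eq_sum_range
            (fun k => κ l b k • toSl (gradH (k + 1) (b.val + 2) l.succ A j))]
          refine Finset.sum_congr rfl fun k _ => ?_
          change _ = _ • comp (diff (lenardH (k.val + 1) (b.val + 2) l.succ) A) j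
          rw [diff_lenardH, comp_trForm]
          simp only [κ]
          rw [dif_pos k.isLt]
    · refine Finset.sum_congr rfl fun s _ => ?_
      change _ = _ • comp (diff (extraFamily (M + 1) r s) A) j
      rw [diff_extraFamily, comp_trForm]
  have hZ : ∀ (l : Fin M) (j : Fin (M + 1)), j < l.succ →
      ∑ b : Fin (r - 1), ∑ k ∈ Finset.range (b.val + 2),
        κ l b k • toSl (gradH (k + 1) (b.val + 2) l.succ A j) = Z l := fun l j hj => by
    refine Finset.sum_congr rfl fun b _ => ?_
    rw [Finset.smul_sum]
    refine Finset.sum_congr rfl fun k _ => ?_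
    rw [gradH_of_lt A hj, smul_comm]
    congr 1
    exact map_smul (toSlLin r) _ _
  have hW : ∀ l : Fin M, ∑ b : Fin (r - 1), ∑ k ∈ Finset.range (b.val + 2),
        κ l b k • toSl (gradH (k + 1) (b.val + 2) l.succ A l.succ) = W l := fun l => by
    refine Finset.sum_congr rfl fun b _ => ?_
    rw [Finset.smul_sum]
    refine Finset.sum_congr rfl fun k _ => ?_
    rw [gradH_self, smul_comm]
    congr 1
    exact map_smul (toSlLin r) _ _
  have hgt : ∀ (α β : ℕ) (l j : Fin (M + 1)), l < j → toSl (gradH α β l A j) = 0 :=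
    fun α β l j hj => by
      rw [gradH_of_gt A hj]
      exact map_zero (toSlLin r)
  have hrel0 : ∑ b, (((b.val + 2 : ℕ) : ℂ) * a b) • toSl (headSum A 0 ^ (b.val + 1))
      + ∑ l : Fin M, Z l + Y = 0 := by
    refine Eq.trans ?_ (hrel 0)
    congr 2
    · refine Finset.sum_congr rfl fun b _ => ?_
      rw [gradH_self, pencilShift_succ, show b.val + 2 - 1 = b.val + 1 by omega, pencil_self,
        headSum_zero, mul_comm, mul_smul]
      congr 1
      exact (map_smul (toSlLin r) _ _).symm
    · exact Finset.sum_congr rfl fun l _ => (hZ l 0 (Fin.succ_pos l)).symm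
  have hrelS : ∀ j : Fin M, W j + ∑ l ∈ Finset.univ.filter (j < ·), Z l + Y = 0 := by
    intro j
    refine Eq.trans ?_ (hrel j.succ)
    congr 1
    rw [Finset.sum_eq_zero (s := Finset.univ (α := Fin (r - 1))) fun b _ => by
      rw [hgt _ _ _ _ (Fin.succ_pos j), smul_zero], zero_add,
      ← Finset.add_sum_erase _ _ (Finset.mem_univ j), hW, Finset.sum_filter,
      ← Finset.add_sum_erase _ _ (Finset.mem_univ j), if_neg (lt_irrefl j), zero_add]
    congr 1
    refine Finset.sum_congr rfl fun l hl => ?_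
    have hne := (Finset.mem_erase.1 hl).1
    rcases lt_or_gt_of_ne hne with h | h
    · rw [if_neg h.not_gt]
      symm
      refine Finset.sum_eq_zero fun b _ => Finset.sum_eq_zero fun k _ => ?_
      rw [hgt _ _ _ _ (Fin.succ_lt_succ_iff.2 h), smul_zero]
    · rw [if_pos h, hZ l j.succ (Fin.succ_lt_succ_iff.2 h)]
  have hmain : ∀ n ≤ M,
      (∑ b, (((b.val + 2 : ℕ) : ℂ) * a b) • toSl (headSum A n ^ (b.val + 1))
        + ∑ l ∈ Finset.univ.filter (fun l : Fin M => n ≤ l.val), Z l + Y = 0) ∧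
      ∀ l : Fin M, l.val < n → ∀ b : Fin (r - 1), ∀ k < b.val + 2, κ l b k = a b := by
    intro n
    induction n with
    | zero =>
      intro _
      refine ⟨?_, fun l hl => absurd hl (by omega)⟩
      simpa using hrel0
    | succ n ih =>
      intro hn
      obtain ⟨h1, h2⟩ := ih (by omega)
      let l : Fin M := ⟨n, hn⟩
      have hfl : Finset.univ.filter (fun i : Fin M => n ≤ i.val)
          = insert l (Finset.univ.filter (l < ·)) := by
        ext i
        simp [l, Fin.lt_def, Fin.ext_iff, Nat.le_iff_lt_or_eq, or_comm, eq_comm]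
      have hfl' : Finset.univ.filter (fun i : Fin M => n + 1 ≤ i.val)
          = Finset.univ.filter (l < ·) := by
        ext i
        simp [l, Fin.lt_def]
      rw [hfl, Finset.sum_insert (by simp)] at h1
      have h3 := hrelS l
      -- Subtract the relations at two consecutive sites.
      have h4 : ∑ b, (((b.val + 2 : ℕ) : ℂ) * a b) • T l b 0 + Z l - W l = 0 := by
        have h5 : ∀ b : Fin (r - 1), toSl (headSum A n ^ (b.val + 1)) = T l b 0 := fun b => by
          simp only [T]
          rw [pencil_coeff_zero, ← headSum_eq_partialSum]
        simp only [h5] at h1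
        rw [← sub_eq_zero.2 (h1.trans h3.symm)]
        abel
      have h5 : ∑ x : Σ b : Fin (r - 1), Fin (b.val + 2),
          (((x.1.val + 2 : ℕ) : ℂ) * ((if x.2.val = 0 then a x.1 else κ l x.1 (x.2.val - 1))
            - κ l x.1 x.2.val)) • pencilFamily (A l.succ).val (partialSum A l.succ).val x = 0 := by
        rw [← h4, Fintype.sum_sigma]
        simp only [Z, W]
        rw [← Finset.sum_add_distrib, ← Finset.sum_sub_distrib]
        refine Finset.sum_congr rfl fun b _ => ?_
        have hT : T l b (b.val + 2) = 0 := by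
          simp only [T]
          rw [pencil_eq_zero _ _ (by omega)]
          exact map_zero (toSlLin r)
        rw [mul_smul, ← smul_add, ← smul_sub, ← sum_smul_shift (a b) (κ l b) (T l b) (b.val + 1) hT,
          Finset.smul_sum, ← Fin.sum_univ_eq_sum_range (fun k => ((b.val + 2 : ℕ) : ℂ) •
            ((if k = 0 then a b else κ l b (k - 1)) - κ l b k) • T l b k)]
        refine Finset.sum_congr rfl fun k _ => ?_
        rw [mul_smul]; rfl
      have h6 := Fintype.linearIndependent_iff.1 (hpencil l) _ h5
      have h7 : ∀ b : Fin (r - 1), ∀ k < b.val + 2, κ l b k = a b := by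
        intro b k
        induction k with
        | zero =>
          intro hk
          have h8 := (mul_eq_zero.1 (h6 ⟨b, ⟨0, hk⟩⟩)).resolve_left
            (by exact_mod_cast (by omega : b.val + 2 ≠ 0))
          simpa using (sub_eq_zero.1 h8).symm
        | succ k ihk =>
          intro hk
          have h8 := (mul_eq_zero.1 (h6 ⟨b, ⟨k + 1, hk⟩⟩)).resolve_left
            (by exact_mod_cast (by omega : b.val + 2 ≠ 0))
          rw [← ihk (by omega)]
          simpa using (sub_eq_zero.1 h8).symm
      refine ⟨?_, fun i hi => ?_⟩
      · have h8 : W l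
            = ∑ b, (((b.val + 2 : ℕ) : ℂ) * a b) • toSl (headSum A (n + 1) ^ (b.val + 1)) := by
          refine Finset.sum_congr rfl fun b _ => ?_
          have h9 := sum_pencil (A l.succ).val (partialSum A l.succ).val 1 (b.val + 1)
          simp only [one_smul, one_pow] at h9
          rw [show n + 1 = l.val + 1 from rfl, headSum_succ, h9, mul_smul]
          congr 1
          rw [Finset.sum_congr rfl fun k hk => by rw [h7 b k (Finset.mem_range.1 hk)],
            ← Finset.smul_sum]
          congr 1
          exact (map_sum (toSlLin r) _ _).symm
        rw [hfl', ← h8]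
        exact h3
      · rcases Nat.lt_succ_iff_lt_or_eq.1 hi with h | h
        · exact h2 i h
        · have : i = l := Fin.ext h
          rw [this]
          exact h7
  obtain ⟨h1, h2⟩ := hmain M le_rfl
  rw [Finset.filter_false_of_mem (fun l _ => by omega), Finset.sum_empty, add_zero,
    headSum_last] at h1
  have h3 := Fintype.linearIndependent_iff.1 hcetlin
    (Sum.elim (fun b => ((b.val + 2 : ℕ) : ℂ) * a b) fun s => g (Sum.inr (Sum.inr s)))
    (by rw [Fintype.sum_sum_type]; exact h1)
  have ha : ∀ b, a b = 0 := fun b =>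
    (mul_eq_zero.1 (h3 (Sum.inl b))).resolve_left (by exact_mod_cast (by omega : b.val + 2 ≠ 0))
  have hκ : ∀ l b, ∀ k < b.val + 2, κ l b k = 0 := fun l b k hk => by
    rw [h2 l l.isLt b k hk, ha]
  rintro (⟨i, b⟩ | ⟨l, b, k⟩ | s)
  · refine Fin.cases (ha b) (fun l => ?_) i
    simpa [κ] using hκ l b (b.val + 1) (by omega)
  · have := hκ l b k.val (by omega)
    simp only [κ] at this
    rw [dif_pos k.isLt] at this
    exact this
  · exact h3 (Sum.inr s)

/-! ### Completeness and Liouville integrability -/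

/-- The generic points: the complement of the zero set of one holomorphic function. -/
theorem exists_generic (hN : 1 ≤ N) : ∃ D : Phase N r → ℂ, Differentiable ℂ D ∧ (∃ A, D A ≠ 0) ∧
    ∀ A, D A ≠ 0 → (LinearIndependent ℂ fun s => diff (fullFamily N r s) A) ∧
      Module.finrank ℂ (LinearMap.ker (tensorP A)) ≤ N * (r - 1) := by
  obtain ⟨M, rfl⟩ : ∃ M, N = M + 1 := ⟨N - 1, by omega⟩
  choose D₁ hD₁ hne₁ h₁ using fun l : Fin M => exists_pencil_minor (r := r) l
  obtain ⟨D₂, hD₂, hne₂, h₂⟩ := exists_cetlin_minor M r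
  obtain ⟨D₃, hD₃, hne₃, h₃⟩ := exists_corank_bound (M + 1) r
  let D : Fin M ⊕ Fin 2 → Phase (M + 1) r → ℂ := Sum.elim D₁ ![D₂, D₃]
  have hD : ∀ i, Differentiable ℂ (D i) := by
    rintro (l | i)
    · exact hD₁ l
    · fin_cases i
      · exact hD₂
      · exact hD₃
  have hne : ∀ i, ∃ A, D i A ≠ 0 := by
    rintro (l | i)
    · exact hne₁ l
    · fin_cases i
      · exact hne₂
      · exact hne₃
  refine ⟨fun A => ∏ i, D i A, differentiable_finsetProd _ hD, exists_forall_ne_zero D hD hne,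
    fun A hA => ?_⟩
  have hA' := fun i => Finset.prod_ne_zero_iff.1 hA i (Finset.mem_univ i)
  exact ⟨linearIndependent_diff_fullFamily A (fun l => h₁ l A (hA' (Sum.inl l)))
    (h₂ A (hA' (Sum.inr 0))), h₃ A (hA' (Sum.inr 1))⟩

theorem span_casimir_le_ker (A : Phase N r) :
    Submodule.span ℂ (Set.range fun s => diff (casimirFamily N r s) A)
      ≤ LinearMap.ker (tensorP A) := by
  rw [Submodule.span_le]
  rintro _ ⟨s, rfl⟩
  change tensorP A (diff (casimir (s.2.val + 2) s.1) A) = 0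
  rw [casimir_eq, tensorP_diff_casimir]

theorem linearIndependent_split {A : Phase N r}
    (hli : LinearIndependent ℂ fun s => diff (fullFamily N r s) A) :
    LinearIndependent ℂ (fun s => diff (casimirFamily N r s) A) ∧
    LinearIndependent ℂ (fun s => diff (hamiltonianFamily N r s) A) ∧
    Disjoint (Submodule.span ℂ (Set.range fun s => diff (casimirFamily N r s) A))
      (Submodule.span ℂ (Set.range fun s => diff (hamiltonianFamily N r s) A)) := by
  have h := linearIndependent_sum.1 hli
  exact h

/-- At a generic point the kernel of `P` is spanned by the differentials of the Casimirs. -/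
theorem span_casimir_eq_ker {A : Phase N r}
    (hli : LinearIndependent ℂ fun s => diff (fullFamily N r s) A)
    (hker : Module.finrank ℂ (LinearMap.ker (tensorP A)) ≤ N * (r - 1)) :
    Submodule.span ℂ (Set.range fun s => diff (casimirFamily N r s) A)
      = LinearMap.ker (tensorP A) := by
  refine Submodule.eq_of_le_of_finrank_le (span_casimir_le_ker A) ?_
  rw [finrank_span_eq_card (linearIndependent_split hli).1, card_casimirIdx]
  exact hker

theorem finrank_ker_generic {A : Phase N r}
    (hli : LinearIndependent ℂ fun s => diff (fullFamily N r s) A)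
    (hker : Module.finrank ℂ (LinearMap.ker (tensorP A)) ≤ N * (r - 1)) :
    Module.finrank ℂ (LinearMap.ker (tensorP A)) = N * (r - 1) := by
  rw [← span_casimir_eq_ker hli hker, finrank_span_eq_card (linearIndependent_split hli).1,
    card_casimirIdx]

/-- A combination of the Hamiltonians that is constant along the leaf lies in the kernel of `P`,
that is, in the span of the Casimirs, and hence vanishes. -/
theorem linearIndependent_restrict {A : Phase N r}
    (hli : LinearIndependent ℂ fun s => diff (fullFamily N r s) A)
    (hker : Module.finrank ℂ (LinearMap.ker (tensorP A)) ≤ N * (r - 1)) :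
    LinearIndependent ℂ
      (fun s => (diff (hamiltonianFamily N r s) A).domRestrict (leafTangent A)) := by
  obtain ⟨_, h2, h3⟩ := linearIndependent_split hli
  rw [Fintype.linearIndependent_iff]
  intro c hc
  set ξ := ∑ s, c s • diff (hamiltonianFamily N r s) A with hξ
  have h4 : ∀ η, ξ (tensorP A η) = 0 := fun η => by
    have h := congrArg (fun f => f ⟨tensorP A η, LinearMap.mem_range_self _ η⟩) hc
    simpa [hξ] using h
  have h5 : tensorP A ξ = 0 := by
    refine (Module.forall_dual_apply_eq_zero_iff ℂ _).1 fun η => ?_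
    rw [pairing_antisymm, h4, neg_zero]
  have h6 : ξ ∈ Submodule.span ℂ (Set.range fun s => diff (casimirFamily N r s) A) := by
    rw [span_casimir_eq_ker hli hker]
    exact h5
  have h7 : ξ ∈ Submodule.span ℂ (Set.range fun s => diff (hamiltonianFamily N r s) A) :=
    sum_mem fun s _ => Submodule.smul_mem _ _ (Submodule.subset_span ⟨s, rfl⟩)
  exact Fintype.linearIndependent_iff.1 h2 c (Submodule.disjoint_def.1 h3 ξ h6 h7)

theorem card_hamiltonian (hN : 1 ≤ N) (hr : 2 ≤ r) :
    2 * Fintype.card (ChainIdx N r ⊕ (CartanIdx r ⊕ GCIdx r)) = N * (r * (r - 1)) := by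
  rw [Fintype.card_sum, card_chainIdx hr, card_extraIdx hr]
  have h : 2 * (r * (r - 1) / 2) = r * (r - 1) :=
    Nat.mul_div_cancel' (Nat.even_mul_pred_self r).two_dvd
  obtain ⟨M, rfl⟩ : ∃ M, N = M + 1 := ⟨N - 1, by omega⟩
  rw [Nat.add_sub_cancel, mul_add, mul_left_comm, h]
  ring

theorem isCompleteInvolutive_fullFamily (hN : 1 ≤ N) (hr : 2 ≤ r) :
    IsCompleteInvolutive (fullFamily N r) where
  differentiable := differentiable_fullFamily
  involutive := bracketP_fullFamily
  complete := by
    obtain ⟨D, hD, ⟨A₀, h0⟩, h⟩ := exists_generic (r := r) hN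
    refine ⟨{A | D A ≠ 0}, isOpen_ne.preimage hD.continuous, dense_ne_zero hD h0, fun A hA => ?_⟩
    obtain ⟨hli, hker⟩ := h A hA
    refine ⟨hli, ?_⟩
    rw [finrank_ker_generic hli hker, Fintype.card_sum, mul_add, card_hamiltonian hN hr,
      card_casimirIdx]
    have h1 := finrank_phase (N := N) (r := r) (by omega)
    obtain ⟨q, rfl⟩ : ∃ q, r = q + 1 := ⟨r - 1, by omega⟩
    rw [Nat.add_sub_cancel]
    nlinarith

theorem isLiouvilleIntegrable_gaudinH (hN : 1 ≤ N) (hr : 2 ≤ r) :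
    IsLiouvilleIntegrable (gaudinH : Phase N r → ℂ) (hamiltonianFamily N r) where
  differentiable_ham := by
    rw [gaudinH_eq]
    exact Differentiable.fun_sum fun l _ => differentiable_lenardH 1 2 l
  differentiable s := differentiable_fullFamily (Sum.inr s)
  commute_ham s A := by
    have h : (gaudinH : Phase N r → ℂ) = fun A =>
        ∑ l ∈ Finset.univ.filter (fun l : Fin N => 0 < l.val), 1 * lenardH 1 2 l A := by
      rw [gaudinH_eq]; simp
    rw [bracketP, h, diff_sum _ (fun _ => 1) (fun l : Fin N => lenardH 1 2 l)
      fun l => differentiable_lenardH 1 2 l, LinearMap.sum_apply]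
    refine Finset.sum_eq_zero fun l _ => ?_
    rw [LinearMap.smul_apply, pairing_antisymm]
    have := pairing_lenardH (Sum.inr s) 1 2 l A
    change diff (hamiltonianFamily N r s) A _ = 0 at this
    rw [this, neg_zero, smul_zero]
  involutive s t A := bracketP_fullFamily (Sum.inr s) (Sum.inr t) A
  independent := by
    obtain ⟨D, hD, ⟨A₀, h0⟩, h⟩ := exists_generic (r := r) hN
    refine ⟨{A | D A ≠ 0}, isOpen_ne.preimage hD.continuous, dense_ne_zero hD h0,
      fun A hA => leaf_subset_closure hD hA, fun A hA => ?_⟩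
    obtain ⟨hli, hker⟩ := h A hA
    refine ⟨?_, linearIndependent_restrict hli hker⟩
    have h1 := finrank_phase (N := N) (r := r) (by omega)
    have h2 := finrank_range_add_ker A
    rw [finrank_ker_generic hli hker] at h2
    rw [card_hamiltonian hN hr, leafTangent]
    obtain ⟨q, rfl⟩ : ∃ q, r = q + 1 := ⟨r - 1, by omega⟩
    rw [Nat.add_sub_cancel] at h2 ⊢
    nlinarith


end Gaudin

theorem mainTheorem4 (N r : ℕ) (hN : 1 ≤ N) (hr : 2 ≤ r) :
    -- the Lenard chains of `R - λ P`, each starting at a Casimir of `P`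
    (∀ (l : Fin N), 0 < l.val → ∀ β : ℕ,
      (∀ α : ℕ, 1 ≤ α → α ≤ β → ∀ A : Gaudin.Phase N r,
        Gaudin.tensorP A (Gaudin.diff (Gaudin.lenardK (α - 1) β l) A)
          = Gaudin.tensorR A (Gaudin.diff (Gaudin.lenardK α β l) A)) ∧
      (Gaudin.lenardK β β l : Gaudin.Phase N r → ℂ) = Gaudin.casimir β l ∧
      Submodule.span ℂ ((fun α => (Gaudin.lenardK α β l : Gaudin.Phase N r → ℂ)) ''
          Set.Icc 1 (β - 1))
        = Submodule.span ℂ ((fun α => (Gaudin.lenardH α β l : Gaudin.Phase N r → ℂ)) ''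
          Set.Icc 1 (β - 1))) ∧
    -- the Casimirs of `P`, and the common Casimirs of `P` and `R`
    (∀ (β : ℕ) (i : Fin N) (A : Gaudin.Phase N r),
      Gaudin.tensorP A (Gaudin.diff (Gaudin.casimir β i) A) = 0 ∧
      (i.val = 0 → Gaudin.tensorR A (Gaudin.diff (Gaudin.casimir β i) A) = 0)) ∧
    -- the numbers of functions
    Fintype.card (Gaudin.ChainIdx N r) = (N - 1) * (r * (r - 1) / 2) ∧
    Fintype.card (Gaudin.CasimirIdx N r) = N * (r - 1) ∧
    Fintype.card (Gaudin.CartanIdx r ⊕ Gaudin.GCIdx r) = r * (r - 1) / 2 ∧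
    -- completeness, and involution for both brackets
    Gaudin.IsCompleteInvolutive (Gaudin.fullFamily N r) ∧
    (∀ s t A, Gaudin.bracketR (Gaudin.fullFamily N r s) (Gaudin.fullFamily N r t) A = 0) ∧
    -- Liouville integrability of the homogeneous Gaudin model
    (Gaudin.gaudinH : Gaudin.Phase N r → ℂ)
      = (fun A => ∑ l ∈ Finset.univ.filter (fun l : Fin N => 0 < l.val), Gaudin.lenardH 1 2 l A) ∧
    Gaudin.IsLiouvilleIntegrable (Gaudin.gaudinH : Gaudin.Phase N r → ℂ)
      (Gaudin.hamiltonianFamily N r) := by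
  refine ⟨fun l _ β => ⟨fun α h1 h2 A => Gaudin.lenard_chain l h1 h2 A, ?_,
    Gaudin.span_lenardK l β⟩, fun β i A => ?_, Gaudin.card_chainIdx hr, Gaudin.card_casimirIdx,
    Gaudin.card_extraIdx hr, Gaudin.isCompleteInvolutive_fullFamily hN hr,
    Gaudin.bracketR_fullFamily, Gaudin.gaudinH_eq, Gaudin.isLiouvilleIntegrable_gaudinH hN hr⟩
  · rw [Gaudin.lenardK_self, Gaudin.casimir_eq]
  · rw [Gaudin.casimir_eq]
    exact ⟨Gaudin.tensorP_diff_casimir β i A, fun h => Gaudin.tensorR_diff_casimir β i h A⟩
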